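/- Let $G=\widetilde{SL}_2$ be the universal covering group of $SL(2,\mathbb R)\cong SU(1,1)$, and let $$e_1=\tfrac12\begin{pmatrix}0&1\\1&0\end{pmatrix},\quad e_2=\tfrac12\begin{pmatrix}0&i\\-i&0\end{pmatrix},\quad e_3=\tfrac12\begin{pmatrix}i/2&0\\0&-i/2\end{pmatrix}$$ be the basis of its Lie algebra $\mathfrak{su}(1,1)$; endow $G$ with the left invariant Riemannian metric for which $e_1,e_2,e_3$ is orthonormal, and with the orientation in which this basis is positive. Let $f:M\to G$ be a smooth immersion of a closed oriented surface, and regard $M$ as a compact Riemann surface whose holomorphic local parameters $z=x+iy$ are conformal for the induced metric. In a local parameter $z$ write $f^{-1}\partial f=\sum_k Z_ke_k$ with $\partial=\frac12(\partial_x-i\partial_y)$. A generating spinor $(\psi_1,\psi_2)$ is a pair of smooth complex functions with $$Z_1=\tfrac i2(\bar\psi_2^2+\psi_1^2),\qquad Z_2=\tfrac12(\bar\psi_2^2-\psi_1^2),\qquad Z_3=\psi_1\bar\psi_2,$$ and its Dirac potentials are continuous complex functions $U,V$ with $$\partial\psi_2+U\psi_1=0,\qquad -\bar\partial\psi_1+V\psi_2=0.$$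 Near every point there are such $\psi$, $U$, $V$, and the local expressions $UV\,dx\wedge dy$ define a 2-form on $M$ that does not depend on the choices; the energy of the surface is $E(M)=\int_M UV\,dx\wedge dy$. Then the energy is well defined and real, and $$E(M)=\frac14\int_M\left(H^2+\frac5{16}\widehat K-\frac14\right)d\mu,$$ where $H$ is the mean curvature (half of the trace of the second fundamental form), $\widehat K$ is the sectional curvature of $G$ along the tangent plane of the surface, and $d\mu$ is the induced area measure; the integrand on the right is integrable. -/

import Mathlib

open scoped ContDiff Manifold Matrix ComplexConjugate

/-- The manifold underlying the universal covering group of `SL(2, ℝ) ≅ SU(1,1)`: pairs `(z, φ)`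
with `z` in the unit disc (a point of the hyperbolic plane) and `φ ∈ ℝ` (the lifted angle of a unit
tangent vector at `z`). -/
def slTildeOpens : TopologicalSpace.Opens (ℂ × ℝ) :=
  ⟨{q | ‖q.1‖ < 1}, isOpen_lt (by fun_prop) continuous_const⟩

/-- The universal covering group of `SL(2, ℝ)`, as an open subset of `ℂ × ℝ`. -/
abbrev SLTilde : Type := slTildeOpens

namespace SLTilde

/-- The base point in the unit disc. -/
def z (g : SLTilde) : ℂ := g.1.1

/-- The lifted angle. -/
def ang (g : SLTilde) : ℝ := g.1.2

theorem norm_z_lt (g : SLTilde) : ‖g.z‖ < 1 := g.2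

theorem ext' {g h : SLTilde} (h1 : g.z = h.z) (h2 : g.ang = h.ang) : g = h :=
  Subtype.ext (Prod.ext h1 h2)

theorem normSq_diff (a u : ℂ) :
    ‖1 + conj a * u‖ ^ 2 - ‖a + u‖ ^ 2 = (1 - ‖a‖ ^ 2) * (1 - ‖u‖ ^ 2) := by
  simp only [← Complex.normSq_eq_norm_sq, Complex.normSq_apply, Complex.add_re, Complex.add_im,
    Complex.mul_re, Complex.mul_im, Complex.conj_re, Complex.conj_im, Complex.one_re,
    Complex.one_im]
  ring

theorem norm_rot (t : ℝ) (w : ℂ) : ‖Complex.exp (t * Complex.I) * w‖ = ‖w‖ := by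
  rw [norm_mul, Complex.norm_exp_ofReal_mul_I, one_mul]

theorem mobius_lt {a u : ℂ} (ha : ‖a‖ < 1) (hu : ‖u‖ < 1) :
    ‖(a + u) / (1 + conj a * u)‖ < 1 := by
  have h := normSq_diff a u
  have h1 : 0 < (1 - ‖a‖ ^ 2) * (1 - ‖u‖ ^ 2) := by
    apply mul_pos <;> nlinarith [norm_nonneg a, norm_nonneg u]
  have h2 : ‖a + u‖ < ‖1 + conj a * u‖ := lt_of_pow_lt_pow_left₀ 2 (norm_nonneg _) (by linarith)
  rw [norm_div, div_lt_one (lt_of_le_of_lt (norm_nonneg _) h2)]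
  exact h2

/-- The fractional linear action on the disc in the first component; in the second component the
angles add up with the continuously lifted correction term. -/
noncomputable instance : Mul SLTilde where
  mul g h :=
    ⟨((g.z + Complex.exp (g.ang * Complex.I) * h.z) /
        (1 + conj g.z * (Complex.exp (g.ang * Complex.I) * h.z)),
      g.ang + h.ang +
        2 * Complex.arg (1 + g.z * conj (Complex.exp (g.ang * Complex.I) * h.z))),
      mobius_lt g.norm_z_lt (by rw [norm_rot]; exact h.norm_z_lt)⟩

noncomputable instance : One SLTilde where
  one := ⟨(0, 0), by simp [slTildeOpens]⟩

noncomputable instance : Inv SLTilde where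
  inv g := ⟨(-(Complex.exp (-g.ang * Complex.I) * g.z), -g.ang), by
    have := norm_rot (-g.ang) g.z
    have h := g.norm_z_lt
    push_cast at this
    change ‖-(Complex.exp (-g.ang * Complex.I) * g.z)‖ < 1
    rw [norm_neg, this]
    exact h⟩

theorem mul_z (g h : SLTilde) : (g * h).z =
    (g.z + Complex.exp (g.ang * Complex.I) * h.z) /
        (1 + conj g.z * (Complex.exp (g.ang * Complex.I) * h.z)) := rfl

theorem mul_ang (g h : SLTilde) : (g * h).ang = g.ang + h.ang +
    2 * Complex.arg (1 + g.z * conj (Complex.exp (g.ang * Complex.I) * h.z)) := rfl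

theorem one_z : (1 : SLTilde).z = 0 := rfl
theorem one_ang : (1 : SLTilde).ang = 0 := rfl
theorem inv_z (g : SLTilde) : (g⁻¹).z = -(Complex.exp (-g.ang * Complex.I) * g.z) := rfl
theorem inv_ang (g : SLTilde) : (g⁻¹).ang = -g.ang := rfl

/-- The covering homomorphism onto `SU(1,1)` (see `mat_mul`); its kernel is `{(0, 4πk) : k ∈ ℤ}` and
its source, disc times line, is simply connected. The matrix covered by `g` is as follows: with `c = (1 - |z|²)^(-1/2)` its first row is
`(c e^{iφ/2}, c z e^{-iφ/2})` and its second row is the conjugate of the reversed first row. -/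
noncomputable def mat (g : SLTilde) : Matrix (Fin 2) (Fin 2) ℂ :=
  let c : ℂ := ((Real.sqrt (1 - ‖g.z‖ ^ 2))⁻¹ : ℝ)
  !![c * Complex.exp (g.ang / 2 * Complex.I), c * g.z * Complex.exp (-(g.ang / 2) * Complex.I);
     c * conj g.z * Complex.exp (g.ang / 2 * Complex.I),
     c * Complex.exp (-(g.ang / 2) * Complex.I)]

theorem pos (g : SLTilde) : 0 < 1 - ‖g.z‖ ^ 2 := by
  nlinarith [norm_nonneg g.z, g.norm_z_lt]

theorem abs_arg_lt {a u : ℂ} (ha : ‖a‖ < 1) (hu : ‖u‖ < 1) :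
    |Complex.arg (1 + a * conj u)| < Real.pi / 2 := by
  rw [Complex.abs_arg_lt_pi_div_two_iff]
  left
  have h1 : ‖a * conj u‖ < 1 := by
    rw [norm_mul, RCLike.norm_conj]
    nlinarith [norm_nonneg a, norm_nonneg u]
  have h2 := (abs_le.1 (Complex.abs_re_le_norm (a * conj u))).1
  rw [Complex.add_re, Complex.one_re]
  linarith

theorem mat_mul (g h : SLTilde) : (g * h).mat = g.mat * h.mat := by
  set a := g.z with ha
  set b := h.z with hb
  set u := Complex.exp (g.ang * Complex.I) * b with hu
  set q := 1 + a * conj u with hq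
  have hau : ‖a‖ < 1 := g.norm_z_lt
  have hub : ‖u‖ = ‖b‖ := norm_rot _ _
  have huu : ‖u‖ < 1 := by rw [hub]; exact h.norm_z_lt
  have hcq : conj q = 1 + conj a * u := by simp [hq]
  have hA : 0 < 1 - ‖a‖ ^ 2 := g.pos
  have hB : 0 < 1 - ‖b‖ ^ 2 := h.pos
  have hd := normSq_diff a u
  rw [← hcq, RCLike.norm_conj, hub] at hd
  have hs : 0 < ‖q‖ := by
    have : 0 < ‖q‖ ^ 2 := by nlinarith [mul_pos hA hB, sq_nonneg ‖a + u‖]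
    exact (sq_pos_iff.1 this).lt_of_le' (norm_nonneg _)
  have hz : (g * h).z = (a + u) / conj q := by rw [hcq]; rfl
  have hang : (g * h).ang = g.ang + h.ang + 2 * Complex.arg q := rfl
  have hc : (Real.sqrt (1 - ‖(g * h).z‖ ^ 2))⁻¹ =
      (Real.sqrt (1 - ‖a‖ ^ 2))⁻¹ * (Real.sqrt (1 - ‖b‖ ^ 2))⁻¹ * ‖q‖ := by
    have : 1 - ‖(g * h).z‖ ^ 2 = (1 - ‖a‖ ^ 2) * (1 - ‖b‖ ^ 2) / ‖q‖ ^ 2 := by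
      rw [hz, norm_div, RCLike.norm_conj, ← hd]
      field_simp
    rw [this, Real.sqrt_div (mul_pos hA hB).le, Real.sqrt_mul hA.le, Real.sqrt_sq hs.le]
    field_simp
  set E := Complex.exp (g.ang / 2 * Complex.I) with hE
  set E' := Complex.exp (h.ang / 2 * Complex.I) with hE'
  set T := Complex.exp (Complex.arg q * Complex.I) with hT
  have e1 : Complex.exp (-(g.ang / 2) * Complex.I) = E⁻¹ := by
    rw [neg_mul, Complex.exp_neg]
  have e2 : Complex.exp (-(h.ang / 2) * Complex.I) = E'⁻¹ := by
    rw [neg_mul, Complex.exp_neg]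
  have e3 : Complex.exp (((g * h).ang : ℝ) / 2 * Complex.I) = E * E' * T := by
    rw [hang, hE, hE', hT, ← Complex.exp_add, ← Complex.exp_add]
    congr 1
    push_cast
    ring
  have e4 : Complex.exp (-(((g * h).ang : ℝ) / 2) * Complex.I) = E⁻¹ * E'⁻¹ * T⁻¹ := by
    rw [neg_mul, Complex.exp_neg, e3, mul_inv, mul_inv]
  have e5 : Complex.exp (g.ang * Complex.I) = E ^ 2 := by
    rw [hE, ← Complex.exp_nat_mul]
    congr 1
    push_cast
    ring
  have hE0 : E ≠ 0 := Complex.exp_ne_zero _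
  have hE'0 : E' ≠ 0 := Complex.exp_ne_zero _
  have hT0 : T ≠ 0 := Complex.exp_ne_zero _
  have cE : conj E = E⁻¹ := by
    rw [hE, ← Complex.exp_conj, ← e1]
    congr 1
    rw [map_mul, map_div₀, Complex.conj_ofReal, Complex.conj_I, map_ofNat]
    ring
  have cT : conj T = T⁻¹ := by
    rw [hT, ← Complex.exp_conj, ← Complex.exp_neg]
    congr 1
    simp
  have hqT : (‖q‖ : ℂ) * T = q := Complex.norm_mul_exp_arg_mul_I q
  have hqT' : (‖q‖ : ℂ) * T⁻¹ = conj q := by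
    conv_rhs => rw [← hqT, map_mul, cT, Complex.conj_ofReal]
  have hu2 : u = E ^ 2 * b := by rw [hu, e5]
  have hcu : conj u = E⁻¹ ^ 2 * conj b := by rw [hu2, map_mul, map_pow, cE]
  have hq0 : q ≠ 0 := norm_pos_iff.1 hs
  have hcq0 : conj q ≠ 0 := (map_ne_zero _).2 hq0
  have hcz : conj ((a + u) / conj q) = (conj a + conj u) / q := by
    rw [map_div₀, map_add, Complex.conj_conj]
  have k1 : q = 1 + a * (E⁻¹ ^ 2 * conj b) := by rw [hq, hcu]
  have k2 : conj q = 1 + conj a * (E ^ 2 * b) := by rw [hcq, hu2]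
  rw [hz] at hc
  simp only [mat, hc, e1, e2, e3, e4, hz, ← ha, ← hb, ← hE, ← hE', hcz]
  clear_value a b u q E E' T
  set c : ℂ := (((Real.sqrt (1 - ‖a‖ ^ 2))⁻¹ : ℝ) : ℂ)
  set c' : ℂ := (((Real.sqrt (1 - ‖b‖ ^ 2))⁻¹ : ℝ) : ℂ)
  have hcc : (((Real.sqrt (1 - ‖a‖ ^ 2))⁻¹ * (Real.sqrt (1 - ‖b‖ ^ 2))⁻¹ * ‖q‖ : ℝ) : ℂ) =
      c * c' * ‖q‖ := by simp only [Complex.ofReal_mul]; rfl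
  rw [hcc]
  clear_value c c'
  have m1 : c * c' * ‖q‖ * (E * E' * T) = c * c' * E * E' * q := by
    conv_rhs => rw [← hqT]
    ring
  have m2 : c * c' * ‖q‖ * (E⁻¹ * E'⁻¹ * T⁻¹) = c * c' * E⁻¹ * E'⁻¹ * conj q := by
    rw [← hqT']; ring
  ext i j
  fin_cases i <;> fin_cases j
  · simp only [Matrix.mul_apply, Fin.sum_univ_two]
    simp
    rw [m1, k1]
    field_simp
  · simp only [Matrix.mul_apply, Fin.sum_univ_two]
    simp
    have : c * c' * ‖q‖ * ((a + u) / conj q) * (E⁻¹ * E'⁻¹ * T⁻¹) =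
        c * c' * E⁻¹ * E'⁻¹ * (a + u) := by
      calc _ = (c * c' * ‖q‖ * (E⁻¹ * E'⁻¹ * T⁻¹)) * ((a + u) / conj q) := by ring
        _ = _ := by rw [m2]; field_simp
    rw [this, hu2]
    field_simp
    ring
  · simp only [Matrix.mul_apply, Fin.sum_univ_two]
    simp
    have : c * c' * ‖q‖ * ((conj a + conj u) / q) * (E * E' * T) =
        c * c' * E * E' * (conj a + conj u) := by
      calc _ = (c * c' * ‖q‖ * (E * E' * T)) * ((conj a + conj u) / q) := by ring
        _ = _ := by rw [m1]; field_simp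
    rw [this, hcu]
    field_simp
  · simp only [Matrix.mul_apply, Fin.sum_univ_two]
    simp
    rw [m2, k2]
    field_simp
    ring

theorem mat_inj {g h : SLTilde} (hm : g.mat = h.mat) (hb : |g.ang - h.ang| < 4 * Real.pi) :
    g = h := by
  have h00 := congrFun (congrFun hm 0) 0
  have h10 := congrFun (congrFun hm 1) 0
  have hg := Real.sqrt_pos.2 g.pos
  have hh := Real.sqrt_pos.2 h.pos
  simp only [mat, Matrix.of_apply, Matrix.cons_val_zero, Matrix.cons_val_one,
    Matrix.cons_val', Matrix.cons_val_fin_one] at h00 h10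
  have n : ∀ x : ℝ, ‖Complex.exp (x / 2 * Complex.I)‖ = 1 := by
    intro x
    have := Complex.norm_exp_ofReal_mul_I (x / 2)
    push_cast at this
    exact this
  have hc : (Real.sqrt (1 - ‖g.z‖ ^ 2))⁻¹ = (Real.sqrt (1 - ‖h.z‖ ^ 2))⁻¹ := by
    have := congrArg norm h00
    rw [norm_mul, norm_mul, n, n, mul_one, mul_one, Complex.norm_real, Complex.norm_real,
      Real.norm_of_nonneg (inv_pos.2 hg).le, Real.norm_of_nonneg (inv_pos.2 hh).le] at this
    exact this
  rw [hc] at h00 h10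
  have hc0 : (((Real.sqrt (1 - ‖h.z‖ ^ 2))⁻¹ : ℝ) : ℂ) ≠ 0 :=
    Complex.ofReal_ne_zero.2 (inv_pos.2 hh).ne'
  have he := mul_left_cancel₀ hc0 h00
  rw [he] at h10
  have hz := mul_left_cancel₀ hc0 (mul_right_cancel₀ (Complex.exp_ne_zero _) h10)
  have hz' : g.z = h.z := (starRingEnd ℂ).injective hz
  refine ext' hz' ?_
  obtain ⟨k, hk⟩ := Complex.exp_eq_exp_iff_exists_int.1 he
  have hk' : g.ang = h.ang + 4 * Real.pi * k := by
    have := congrArg Complex.im hk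
    simp at this
    linarith
  have hk0 : k = 0 := by
    rw [hk'] at hb
    have : |4 * Real.pi * k| < 4 * Real.pi * 1 := by
      simpa [mul_assoc] using hb
    rw [abs_mul, abs_of_pos (by positivity)] at this
    have h1 := lt_of_mul_lt_mul_left this (by positivity)
    have h2 : |k| < 1 := by exact_mod_cast h1
    exact Int.abs_lt_one_iff.1 h2
  rw [hk', hk0]
  simp

noncomputable instance : Group SLTilde :=
  Group.ofLeftAxioms
    (by
      intro a b c
      apply mat_inj
      · simp only [mat_mul, Matrix.mul_assoc]
      · have e : ∀ g h : SLTilde, |(g * h).ang - g.ang - h.ang| < Real.pi := by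
          intro g h
          have := abs_arg_lt g.norm_z_lt
            (u := Complex.exp (g.ang * Complex.I) * h.z) (by rw [norm_rot]; exact h.norm_z_lt)
          rw [mul_ang]
          rw [abs_lt] at this ⊢
          constructor <;> linarith [this.1, this.2]
        have h1 := abs_lt.1 (e (a * b) c)
        have h2 := abs_lt.1 (e a b)
        have h3 := abs_lt.1 (e a (b * c))
        have h4 := abs_lt.1 (e b c)
        rw [abs_lt]
        constructor <;> linarith [h1.1, h1.2, h2.1, h2.2, h3.1, h3.2, h4.1, h4.2])
    (by
      intro a
      apply ext'
      · simp [mul_z, one_z, one_ang]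
      · simp [mul_ang, one_z, one_ang])
    (by
      intro a
      have hu : ‖Complex.exp (-a.ang * Complex.I) * a.z‖ < 1 := by
        have := norm_rot (-a.ang) a.z
        push_cast at this
        rw [this]; exact a.norm_z_lt
      apply ext'
      · simp [mul_z, one_z, inv_z, inv_ang]
      · simp only [mul_ang, one_ang, inv_z, inv_ang]
        have : 1 + -(Complex.exp (-a.ang * Complex.I) * a.z) *
            conj (Complex.exp ((-a.ang : ℝ) * Complex.I) * a.z) =
            ((1 - ‖Complex.exp (-a.ang * Complex.I) * a.z‖ ^ 2 : ℝ) : ℂ) := by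
          push_cast
          rw [neg_mul, Complex.mul_conj']
          ring
        rw [this, Complex.arg_ofReal_of_nonneg]
        · ring
        · nlinarith [norm_nonneg (Complex.exp (-a.ang * Complex.I) * a.z)])


/-! ### The Lie algebra, its left invariant metric, connection and curvature -/

/-- The basis `e₁, e₂, e₃` of the Lie algebra `su(1,1)`. -/
noncomputable def basis : Fin 3 → Matrix (Fin 2) (Fin 2) ℂ :=
  ![(1 / 2 : ℂ) • !![0, 1; 1, 0],
    (1 / 2 : ℂ) • !![0, Complex.I; -Complex.I, 0],
    (1 / 2 : ℂ) • !![Complex.I / 2, 0; 0, -(Complex.I / 2)]]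

/-- The element of `su(1,1)` with given coordinates in the basis `e₁, e₂, e₃`. -/
noncomputable def ofCoord (x : Fin 3 → ℝ) : Matrix (Fin 2) (Fin 2) ℂ :=
  ∑ k, (x k : ℂ) • basis k

/-- The coordinates of an element of `su(1,1)` in the basis `e₁, e₂, e₃`. -/
def coord (A : Matrix (Fin 2) (Fin 2) ℂ) : Fin 3 → ℝ :=
  ![2 * (A 0 1).re, 2 * (A 0 1).im, 4 * (A 0 0).im]

theorem coord_ofCoord (x : Fin 3 → ℝ) : coord (ofCoord x) = x := by
  ext k
  fin_cases k <;>
    simp [coord, ofCoord, basis, Fin.sum_univ_three] <;>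
    ring

/-! Below, elements of the Lie algebra are represented by their coordinates in `e₁, e₂, e₃`. The
left invariant metric is the one for which this basis is orthonormal, so that the inner product of
two elements of the Lie algebra is the dot product of their coordinates. -/

/-- The Lie bracket (the commutator of matrices). -/
noncomputable def bracket (x y : Fin 3 → ℝ) : Fin 3 → ℝ :=
  coord (ofCoord x * ofCoord y - ofCoord y * ofCoord x)

/-- The structure constants `α i j k = ⟨[eᵢ, eⱼ], eₖ⟩`. -/
noncomputable def structConst (i j k : Fin 3) : ℝ :=
  bracket (Pi.single i 1) (Pi.single j 1) ⬝ᵥ Pi.single k 1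

/-- The Levi-Civita connection `∇_x y` of the left invariant metric, for left invariant `x, y`. -/
noncomputable def nabla (x y : Fin 3 → ℝ) : Fin 3 → ℝ := fun i =>
  ∑ k, ∑ j, x k * y j * ((structConst k j i + structConst i k j + structConst i j k) / 2)

/-- The curvature operator `(∇_y ∇_x - ∇_x ∇_y + ∇_[x,y]) w`. -/
noncomputable def curvature (x y w : Fin 3 → ℝ) : Fin 3 → ℝ :=
  nabla y (nabla x w) - nabla x (nabla y w) + nabla (bracket x y) w

/-- The sectional curvature of the plane spanned by `x` and `y`. -/
noncomputable def sectional (x y : Fin 3 → ℝ) : ℝ :=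
  (curvature x y x ⬝ᵥ y) / ((x ⬝ᵥ x) * (y ⬝ᵥ y) - (x ⬝ᵥ y) ^ 2)

end SLTilde

open SLTilde

/-! ### Local geometry of a parametrized surface

`F : ℂ → SLTilde` is a local parametrization of a surface, with parameter `w = x + iy`; the
coordinate directions `∂/∂x`, `∂/∂y` are `1` and `Complex.I`. -/

/-- The left translation `F⁻¹ dF(v)` of the derivative of `F` at `w` in the direction `v`, as an
element of the Lie algebra. -/
noncomputable def leftDeriv (F : ℂ → SLTilde) (w v : ℂ) : Fin 3 → ℝ :=
  coord ((F w)⁻¹.mat * Matrix.of fun i j => fderiv ℝ (fun p => (F p).mat i j) w v)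

/-- The first fundamental form. -/
noncomputable def firstForm (F : ℂ → SLTilde) (w v₁ v₂ : ℂ) : ℝ :=
  leftDeriv F w v₁ ⬝ᵥ leftDeriv F w v₂

/-- The determinant of the first fundamental form. -/
noncomputable def gramDet (F : ℂ → SLTilde) (w : ℂ) : ℝ :=
  firstForm F w 1 1 * firstForm F w Complex.I Complex.I - firstForm F w 1 Complex.I ^ 2

/-- The left translation of the unit normal vector, with `(∂F/∂x, ∂F/∂y, N)` positively oriented
with respect to `e₁, e₂, e₃`. -/
noncomputable def unitNormal (F : ℂ → SLTilde) (w : ℂ) : Fin 3 → ℝ :=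
  let c := crossProduct (leftDeriv F w 1) (leftDeriv F w Complex.I)
  (Real.sqrt (c ⬝ᵥ c))⁻¹ • c

/-- The left translation of the covariant derivative in the direction `v₁` of the tangent field
`dF(v₂)` along the surface. -/
noncomputable def covDeriv (F : ℂ → SLTilde) (w v₁ v₂ : ℂ) : Fin 3 → ℝ :=
  (fun k => fderiv ℝ (fun p => leftDeriv F p v₂ k) w v₁) +
    nabla (leftDeriv F w v₁) (leftDeriv F w v₂)

/-- The second fundamental form. -/
noncomputable def secondForm (F : ℂ → SLTilde) (w v₁ v₂ : ℂ) : ℝ :=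
  covDeriv F w v₁ v₂ ⬝ᵥ unitNormal F w

/-- The mean curvature: half of the trace of the second fundamental form with respect to the first
fundamental form. -/
noncomputable def meanCurvatureAt (F : ℂ → SLTilde) (w : ℂ) : ℝ :=
  (secondForm F w 1 1 * firstForm F w Complex.I Complex.I
    - 2 * secondForm F w 1 Complex.I * firstForm F w 1 Complex.I
    + secondForm F w Complex.I Complex.I * firstForm F w 1 1) / (2 * gramDet F w)

/-- The sectional curvature of the ambient metric along the tangent plane. -/
noncomputable def tangentSectionalAt (F : ℂ → SLTilde) (w : ℂ) : ℝ :=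
  sectional (leftDeriv F w 1) (leftDeriv F w Complex.I)

/-- `∂ = (∂/∂x - i ∂/∂y)/2`. -/
noncomputable def dz (g : ℂ → ℂ) (w : ℂ) : ℂ :=
  (fderiv ℝ g w 1 - Complex.I * fderiv ℝ g w Complex.I) / 2

/-- `∂̄ = (∂/∂x + i ∂/∂y)/2`. -/
noncomputable def dzbar (g : ℂ → ℂ) (w : ℂ) : ℂ :=
  (fderiv ℝ g w 1 + Complex.I * fderiv ℝ g w Complex.I) / 2

/-- The coordinates `Z₁, Z₂, Z₃` of `F⁻¹ ∂F` in the basis `e₁, e₂, e₃`. -/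
noncomputable def zCoord (F : ℂ → SLTilde) (w : ℂ) (k : Fin 3) : ℂ :=
  ((leftDeriv F w 1 k : ℂ) - Complex.I * (leftDeriv F w Complex.I k : ℂ)) / 2

/-- `(ψ₁, ψ₂)` is a generating spinor on `D` of the surface `F`. -/
def IsGeneratingSpinor (F : ℂ → SLTilde) (D : Set ℂ) (ψ₁ ψ₂ : ℂ → ℂ) : Prop :=
  ContDiffOn ℝ ∞ ψ₁ D ∧ ContDiffOn ℝ ∞ ψ₂ D ∧ ∀ w ∈ D,
    zCoord F w 0 = Complex.I / 2 * (conj (ψ₂ w) ^ 2 + ψ₁ w ^ 2) ∧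
    zCoord F w 1 = 1 / 2 * (conj (ψ₂ w) ^ 2 - ψ₁ w ^ 2) ∧
    zCoord F w 2 = ψ₁ w * conj (ψ₂ w)

/-- `U, V` are continuous potentials on `D` such that `(ψ₁, ψ₂)` satisfies the Dirac equation
`∂ψ₂ + U ψ₁ = 0`, `-∂̄ψ₁ + V ψ₂ = 0`. -/
def IsDiracPotential (D : Set ℂ) (ψ₁ ψ₂ U V : ℂ → ℂ) : Prop :=
  ContinuousOn U D ∧ ContinuousOn V D ∧ ∀ w ∈ D,
    dz ψ₂ w + U w * ψ₁ w = 0 ∧ -dzbar ψ₁ w + V w * ψ₂ w = 0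

/-! ### Surfaces

A surface is a Riemann surface `M` with a smooth conformal immersion `f : M → SLTilde`. -/

section Surface

variable {M : Type*} [TopologicalSpace M] [ChartedSpace ℂ M]

/-- The holomorphic local parameters of `M`. -/
def localParams (M : Type*) [TopologicalSpace M] [ChartedSpace ℂ M] :
    Set (OpenPartialHomeomorph M ℂ) :=
  IsManifold.maximalAtlas 𝓘(ℂ) ω M

/-- The surface in a local parameter. -/
noncomputable def inParam (f : M → SLTilde) (e : OpenPartialHomeomorph M ℂ) : ℂ → SLTilde := f ∘ e.symm

/-- `f` is smooth, and in every holomorphic local parameter the induced metric has the form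
`λ (dx² + dy²)` with `λ > 0`. -/
def IsConformalImmersion (f : M → SLTilde) : Prop :=
  ContMDiff 𝓘(ℝ, ℂ) 𝓘(ℝ, ℂ × ℝ) ∞ f ∧
  ∀ e ∈ localParams M, ∀ w ∈ e.target,
    0 < firstForm (inParam f e) w 1 1 ∧
    firstForm (inParam f e) w 1 1 = firstForm (inParam f e) w Complex.I Complex.I ∧
    firstForm (inParam f e) w 1 Complex.I = 0

/-- The mean curvature of the surface. -/
noncomputable def meanCurvature (f : M → SLTilde) (p : M) : ℝ :=
  meanCurvatureAt (inParam f (chartAt ℂ p)) (chartAt ℂ p p)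

/-- The sectional curvature of the ambient metric along the tangent plane of the surface. -/
noncomputable def tangentSectional (f : M → SLTilde) (p : M) : ℝ :=
  tangentSectionalAt (inParam f (chartAt ℂ p)) (chartAt ℂ p p)

/-- The induced area measure of the surface. In a local parameter it is `√(EG - F²) dx dy`; these
local measures agree on overlaps, so that their least upper bound is the global area measure. -/
noncomputable def areaMeasure [MeasurableSpace M] (f : M → SLTilde) : MeasureTheory.Measure M :=
  ⨆ e ∈ localParams M,
    ((MeasureTheory.volume.restrict e.target).withDensity
      fun w => ENNReal.ofReal (Real.sqrt (gramDet (inParam f e) w))).map e.symm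

/-- `E` is a value of the energy `∫_M U V dx ∧ dy`: the integral of the 2-form given locally by
`U V dx ∧ dy` is computed with a finite cover by local parameters on which there are a generating
spinor and its Dirac potentials, and with a partition of unity subordinate to this cover. -/
def IsEnergy (f : M → SLTilde) (E : ℂ) : Prop :=
  ∃ (n : ℕ) (e : Fin n → OpenPartialHomeomorph M ℂ) (ψ₁ ψ₂ U V : Fin n → ℂ → ℂ)
    (ρ : PartitionOfUnity (Fin n) M Set.univ),
    (∀ i, e i ∈ localParams M ∧
      IsGeneratingSpinor (inParam f (e i)) (e i).target (ψ₁ i) (ψ₂ i) ∧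
      IsDiracPotential (e i).target (ψ₁ i) (ψ₂ i) (U i) (V i)) ∧
    ρ.IsSubordinate (fun i => (e i).source) ∧
    E = ∑ i, ∫ w in (e i).target, (ρ i ((e i).symm w) : ℂ) * (U i w * V i w)

end Surface

/-!
Let `n₃` be the component of the unit normal along `e₃`. The structure equations of the surface,
solved for a generating spinor, give Dirac potentials that are explicit in `|ψ₁|²`, `|ψ₂|²` and the
mean curvature `H`, and with `K̂ = 1 - 5 n₃²` their product is
`U V dx ∧ dy = (¼ (H² + 5/16 K̂ - ¼) - 5/8 i H n₃) dμ`. Continuous potentials are determined by the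
spinor wherever `ψ₁ ψ̄₂ = Z₃` does not vanish, and this is a dense set, since the planes orthogonal
to `e₃` form a contact distribution. So the energy is the integral of the right-hand side, and it is
real because `∫ H n₃ dμ = 0`: the field `e₃` is a Killing field, hence its tangential part has
divergence `2 H n₃`.
-/

namespace SLTilde

/-! ### Linear algebra of the Lie algebra -/

theorem bracket_apply (x y : Fin 3 → ℝ) : bracket x y =
    ![(x 1 * y 2 - x 2 * y 1) / 2, (x 2 * y 0 - x 0 * y 2) / 2, -2 * (x 0 * y 1 - x 1 * y 0)] := by
  ext k
  fin_cases k <;>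
    simp [bracket, coord, ofCoord, basis, Fin.sum_univ_three] <;>
    ring

theorem nabla_apply (x y : Fin 3 → ℝ) : nabla x y =
    ![-(x 1 * y 2) - 3 / 2 * (x 2 * y 1), 3 / 2 * (x 2 * y 0) + x 0 * y 2,
      -(x 0 * y 1) + x 1 * y 0] := by
  ext k
  fin_cases k <;>
    simp [nabla, structConst, bracket_apply, Fin.sum_univ_three, Pi.single_apply, dotProduct] <;>
    ring

theorem nabla_sub_nabla_swap (x y : Fin 3 → ℝ) : nabla x y - nabla y x = bracket x y := by
  ext k
  fin_cases k <;> simp [nabla_apply, bracket_apply] <;> ring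

theorem nabla_dotProduct_comm (x y z : Fin 3 → ℝ) : nabla x y ⬝ᵥ z = -(nabla x z ⬝ᵥ y) := by
  simp only [nabla_apply, dotProduct, Fin.sum_univ_three, Matrix.cons_val]
  ring

theorem curvature_dotProduct (x y : Fin 3 → ℝ) :
    curvature x y x ⬝ᵥ y = x ⨯₃ y ⬝ᵥ x ⨯₃ y - 5 * (x ⨯₃ y) 2 ^ 2 := by
  simp only [curvature, nabla_apply, bracket_apply, cross_apply, dotProduct, Fin.sum_univ_three,
    Pi.add_apply, Pi.sub_apply, Matrix.cons_val]
  ring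

theorem sectional_eq_of_cross_ne_zero {x y : Fin 3 → ℝ} (h : x ⨯₃ y ≠ 0) :
    sectional x y = 1 - 5 * ((x ⨯₃ y) 2 ^ 2 / (x ⨯₃ y ⬝ᵥ x ⨯₃ y)) := by
  have hne : x ⨯₃ y ⬝ᵥ x ⨯₃ y ≠ 0 := mt dotProduct_self_eq_zero.1 h
  have hgram : (x ⬝ᵥ x) * (y ⬝ᵥ y) - (x ⬝ᵥ y) ^ 2 = x ⨯₃ y ⬝ᵥ x ⨯₃ y := by
    rw [cross_dot_cross, dotProduct_comm y x, sq]
  rw [sectional, hgram, curvature_dotProduct, sub_div, div_self hne, mul_div_assoc]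

theorem smul_eq_smul_cross_of_orthogonal {R : Type*} [CommRing R] {x y t : Fin 3 → R}
    (hx : x ⬝ᵥ t = 0) (hy : y ⬝ᵥ t = 0) :
    (x ⨯₃ y ⬝ᵥ x ⨯₃ y) • t = (t ⬝ᵥ x ⨯₃ y) • x ⨯₃ y := by
  have hcross : x ⨯₃ y ⨯₃ t = 0 := by simp [cross_cross_eq_smul_sub_smul, hx, hy]
  have htriple := cross_cross_eq_smul_sub_smul (x ⨯₃ y) t (x ⨯₃ y)
  rw [hcross, map_zero, LinearMap.zero_apply] at htriple
  exact sub_eq_zero.1 htriple.symm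

theorem coord_sub (A B : Matrix (Fin 2) (Fin 2) ℂ) : coord (A - B) = coord A - coord B := by
  ext k
  fin_cases k <;> simp [coord] <;> ring

/-- Membership of a matrix in the Lie algebra `su(1,1)`. -/
structure IsSU11Lie (A : Matrix (Fin 2) (Fin 2) ℂ) : Prop where
  apply_one_one : A 1 1 = conj (A 0 0)
  apply_one_zero : A 1 0 = conj (A 0 1)
  trace_eq_zero : A.trace = 0

theorem IsSU11Lie.ofCoord_coord {A : Matrix (Fin 2) (Fin 2) ℂ} (hA : IsSU11Lie A) :
    ofCoord (coord A) = A := by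
  have hre : (A 0 0).re = 0 := by
    have htrace := congrArg Complex.re hA.trace_eq_zero
    rw [Matrix.trace_fin_two, hA.apply_one_one, Complex.add_re, Complex.conj_re,
      Complex.zero_re] at htrace
    linarith
  ext i j
  fin_cases i <;> fin_cases j <;> apply Complex.ext <;>
    simp [ofCoord, coord, basis, Fin.sum_univ_three, hA.apply_one_one, hA.apply_one_zero, hre] <;>
    ring

/-! ### The covering homomorphism -/

theorem mat_one : (1 : SLTilde).mat = 1 := by
  ext i j
  fin_cases i <;> fin_cases j <;> simp [mat, one_z, one_ang]

theorem mat_inv_mul (g : SLTilde) : g⁻¹.mat * g.mat = 1 := by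
  rw [← mat_mul, inv_mul_cancel, mat_one]

theorem mat_apply_one_one (g : SLTilde) : g.mat 1 1 = conj (g.mat 0 0) := by
  simp [mat, ← Complex.exp_conj, map_ofNat]

theorem mat_apply_one_zero (g : SLTilde) : g.mat 1 0 = conj (g.mat 0 1) := by
  simp [mat, ← Complex.exp_conj, map_ofNat]

theorem det_mat (g : SLTilde) : g.mat.det = 1 := by
  have hexp : Complex.exp (g.ang / 2 * Complex.I) * Complex.exp (-(g.ang / 2) * Complex.I) = 1 := by
    rw [← Complex.exp_add, neg_mul, add_neg_cancel, Complex.exp_zero]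
  have hnorm : (((Real.sqrt (1 - ‖g.z‖ ^ 2))⁻¹ : ℝ) : ℂ) ^ 2 * (1 - g.z * conj g.z) = 1 := by
    rw [Complex.mul_conj', ← Complex.ofReal_pow, inv_pow, Real.sq_sqrt g.pos.le]
    exact_mod_cast inv_mul_cancel₀ g.pos.ne'
  simp only [Matrix.det_fin_two, mat, Matrix.of_apply, Matrix.cons_val]
  set c : ℂ := (((Real.sqrt (1 - ‖g.z‖ ^ 2))⁻¹ : ℝ) : ℂ)
  linear_combination c ^ 2 * (1 - g.z * conj g.z) * hexp + hnorm

theorem mat_inv (g : SLTilde) : g⁻¹.mat = g.mat.adjugate :=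
  left_inv_eq_right_inv (mat_inv_mul g) (by rw [Matrix.mul_adjugate, det_mat, one_smul])

/-! ### The Maurer-Cartan equation -/

section MatrixDeriv

variable {E : Type*} [NormedAddCommGroup E] [NormedSpace ℝ E] {m n l : Type*} {w : E}

/-- The directional derivative of a matrix valued function, taken entrywise: no norm on the space
of matrices is needed. -/
noncomputable def matDeriv (A : E → Matrix m n ℂ) (w v : E) : Matrix m n ℂ :=
  Matrix.of fun i j => fderiv ℝ (fun p => A p i j) w v

theorem matDeriv_mul [Fintype n] {A : E → Matrix m n ℂ} {B : E → Matrix n l ℂ}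
    (hA : ∀ i j, DifferentiableAt ℝ (fun p => A p i j) w)
    (hB : ∀ i j, DifferentiableAt ℝ (fun p => B p i j) w) (v : E) :
    matDeriv (fun p => A p * B p) w v = matDeriv A w v * B w + A w * matDeriv B w v := by
  ext i j
  have hsum := HasFDerivAt.fun_sum (u := Finset.univ)
    fun k _ => (hA i k).hasFDerivAt.mul (hB k j).hasFDerivAt
  simp only [matDeriv, Matrix.of_apply, Matrix.mul_apply, Matrix.add_apply]
  refine (congrArg (fun L => L v) hsum.fderiv).trans ?_
  simp only [sum_apply, add_apply,
    smul_apply, smul_eq_mul, ← Finset.sum_add_distrib]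
  exact Finset.sum_congr rfl fun k _ => by ring

theorem matDeriv_swap {A : E → Matrix m n ℂ} (hA : ∀ i j, ContDiffAt ℝ 2 (fun p => A p i j) w)
    (u v : E) :
    matDeriv (fun p => matDeriv A p v) w u = matDeriv (fun p => matDeriv A p u) w v := by
  ext i j
  have hd : DifferentiableAt ℝ (fderiv ℝ fun p => A p i j) w :=
    ((hA i j).fderiv_right (m := 1) (by norm_num)).differentiableAt one_ne_zero
  have happly (a b : E) : fderiv ℝ (fun q => fderiv ℝ (fun p => A p i j) q a) w b =
      fderiv ℝ (fderiv ℝ fun p => A p i j) w b a := by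
    rw [fderiv_clm_apply hd (by fun_prop)]
    simp
  have hsymm := ((hA i j).isSymmSndFDerivAt (by simp)).eq u v
  simp only [matDeriv, Matrix.of_apply, happly, hsymm]

theorem matDeriv_maurerCartan [Fintype n] [DecidableEq n] {A B : E → Matrix n n ℂ}
    (hBA : ∀ p, B p * A p = 1) (hA : ∀ i j, ContDiffAt ℝ 2 (fun p => A p i j) w)
    (hB : ∀ i j, DifferentiableAt ℝ (fun p => B p i j) w) (u v : E) :
    matDeriv (fun p => B p * matDeriv A p u) w v - matDeriv (fun p => B p * matDeriv A p v) w u =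
      B w * matDeriv A w u * (B w * matDeriv A w v) -
        B w * matDeriv A w v * (B w * matDeriv A w u) := by
  have hdA (i j) : DifferentiableAt ℝ (fun p => A p i j) w := (hA i j).differentiableAt (by simp)
  have hddA (a : E) (i j) : DifferentiableAt ℝ (fun p => matDeriv A p a i j) w :=
    (((hA i j).fderiv_right (m := 1) (by norm_num)).clm_apply contDiffAt_const).differentiableAt
      one_ne_zero
  have hinv (a : E) : matDeriv B w a = -(B w * matDeriv A w a * B w) := by
    have hconst : matDeriv B w a * A w + B w * matDeriv A w a = 0 := by
      rw [← matDeriv_mul hB hdA, funext hBA]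
      ext i j
      simp [matDeriv]
    rw [← neg_mul, ← eq_neg_of_add_eq_zero_left hconst, mul_assoc,
      mul_eq_one_comm.1 (hBA w), mul_one]
  rw [matDeriv_mul hB (hddA u), matDeriv_mul hB (hddA v), matDeriv_swap hA, hinv, hinv]
  simp only [mul_assoc]
  noncomm_ring

theorem fderiv_coord {A : E → Matrix (Fin 2) (Fin 2) ℂ}
    (hA : ∀ i j, DifferentiableAt ℝ (fun p => A p i j) w) (v : E) :
    (fun k => fderiv ℝ (fun p => coord (A p) k) w v) = coord (matDeriv A w v) := by
  have hre (c : ℝ) (i j) : fderiv ℝ (fun p => c * (A p i j).re) w v =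
      c * (fderiv ℝ (fun p => A p i j) w v).re :=
    congrArg (fun L => L v)
      ((Complex.reCLM.hasFDerivAt.comp w (hA i j).hasFDerivAt).const_mul c).fderiv
  have him (c : ℝ) (i j) : fderiv ℝ (fun p => c * (A p i j).im) w v =
      c * (fderiv ℝ (fun p => A p i j) w v).im :=
    congrArg (fun L => L v)
      ((Complex.imCLM.hasFDerivAt.comp w (hA i j).hasFDerivAt).const_mul c).fderiv
  ext k
  fin_cases k
  · exact hre 2 0 1
  · exact him 2 0 1
  · exact him 4 0 0

end MatrixDeriv

/-- Smoothness on `D` of a map into `SLTilde`, regarded as an open subset of `ℂ × ℝ`. -/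
def SmoothOn (F : ℂ → SLTilde) (D : Set ℂ) : Prop :=
  ContDiffOn ℝ ∞ (fun w => ((F w).1 : ℂ × ℝ)) D

/-- The derivative `dF(v)` at `w`, left translated to the Lie algebra, as a matrix. -/
noncomputable def leftMat (F : ℂ → SLTilde) (w v : ℂ) : Matrix (Fin 2) (Fin 2) ℂ :=
  (F w)⁻¹.mat * matDeriv (fun p => (F p).mat) w v

/-- The derivative in the direction `u` of the left translation of `dF(v)`. -/
noncomputable def secondLeftDeriv (F : ℂ → SLTilde) (w u v : ℂ) : Fin 3 → ℝ :=
  fun k => fderiv ℝ (fun p => leftDeriv F p v k) w u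

theorem leftDeriv_eq_coord_leftMat (F : ℂ → SLTilde) (w v : ℂ) :
    leftDeriv F w v = coord (leftMat F w v) := rfl

namespace SmoothOn

variable {F : ℂ → SLTilde} {D : Set ℂ} {w : ℂ}

theorem contDiffOn_mat (hF : SmoothOn F D) (i j : Fin 2) :
    ContDiffOn ℝ ∞ (fun p => (F p).mat i j) D := by
  have hz : ContDiffOn ℝ ∞ (fun p => (F p).z) D := contDiff_fst.comp_contDiffOn hF
  have hang : ContDiffOn ℝ ∞ (fun p => ((F p).ang : ℂ)) D :=
    Complex.ofRealCLM.contDiff.comp_contDiffOn (contDiff_snd.comp_contDiffOn hF)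
  have hconj : ContDiffOn ℝ ∞ (fun p => conj (F p).z) D :=
    Complex.conjCLE.contDiff.comp_contDiffOn hz
  have hc : ContDiffOn ℝ ∞ (fun p => (((Real.sqrt (1 - ‖(F p).z‖ ^ 2))⁻¹ : ℝ) : ℂ)) D := by
    refine Complex.ofRealCLM.contDiff.comp_contDiffOn (ContDiffOn.inv (ContDiffOn.sqrt ?_ ?_) ?_)
    · exact contDiffOn_const.sub (hz.norm_sq ℝ)
    · exact fun p _ => (F p).pos.ne'
    · exact fun p _ => (Real.sqrt_pos.2 (F p).pos).ne'
  have hexp : ContDiffOn ℝ ∞ (fun p => Complex.exp ((F p).ang / 2 * Complex.I)) D :=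
    ((hang.div_const 2).mul contDiffOn_const).cexp
  have hexp_neg : ContDiffOn ℝ ∞ (fun p => Complex.exp (-((F p).ang / 2) * Complex.I)) D :=
    ((hang.div_const 2).neg.mul contDiffOn_const).cexp
  fin_cases i <;> fin_cases j
  · exact hc.mul hexp
  · exact (hc.mul hz).mul hexp_neg
  · exact (hc.mul hconj).mul hexp
  · exact hc.mul hexp_neg

theorem contDiffOn_mat_inv (hF : SmoothOn F D) (i j : Fin 2) :
    ContDiffOn ℝ ∞ (fun p => (F p)⁻¹.mat i j) D := by
  simp only [SLTilde.mat_inv, Matrix.adjugate_fin_two]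
  fin_cases i <;> fin_cases j
  · exact hF.contDiffOn_mat 1 1
  · exact (hF.contDiffOn_mat 0 1).neg
  · exact (hF.contDiffOn_mat 1 0).neg
  · exact hF.contDiffOn_mat 0 0

theorem contDiffOn_leftMat (hF : SmoothOn F D) (hD : IsOpen D) (v : ℂ) (i j : Fin 2) :
    ContDiffOn ℝ ∞ (fun p => leftMat F p v i j) D := by
  simp only [leftMat, Matrix.mul_apply]
  exact ContDiffOn.sum fun k _ => (hF.contDiffOn_mat_inv i k).mul
    (((hF.contDiffOn_mat k j).fderiv_of_isOpen hD (by simp)).clm_apply contDiffOn_const)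

theorem contDiffOn_leftDeriv (hF : SmoothOn F D) (hD : IsOpen D) (v : ℂ) (k : Fin 3) :
    ContDiffOn ℝ ∞ (fun p => leftDeriv F p v k) D := by
  have hre (i j) : ContDiffOn ℝ ∞ (fun p => (leftMat F p v i j).re) D :=
    Complex.reCLM.contDiff.comp_contDiffOn (hF.contDiffOn_leftMat hD v i j)
  have him (i j) : ContDiffOn ℝ ∞ (fun p => (leftMat F p v i j).im) D :=
    Complex.imCLM.contDiff.comp_contDiffOn (hF.contDiffOn_leftMat hD v i j)
  simp only [leftDeriv_eq_coord_leftMat]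
  fin_cases k
  · exact contDiffOn_const.mul (hre 0 1)
  · exact contDiffOn_const.mul (him 0 1)
  · exact contDiffOn_const.mul (him 0 0)

theorem isSU11Lie_leftMat (hF : SmoothOn F D) (hD : IsOpen D) (hw : w ∈ D) (v : ℂ) :
    IsSU11Lie (leftMat F w v) := by
  have hd (i j) : HasFDerivAt (fun p => (F p).mat i j) (fderiv ℝ (fun p => (F p).mat i j) w) w :=
    (((hF.contDiffOn_mat i j).contDiffAt (hD.mem_nhds hw)).differentiableAt (by simp)).hasFDerivAt
  have hconj (g : ℂ → ℂ) : fderiv ℝ (fun p => conj (g p)) w v = conj (fderiv ℝ g w v) :=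
    congrArg (fun L => L v) (Complex.conjCLE.comp_fderiv (f := g) (x := w))
  have h11 : fderiv ℝ (fun p => (F p).mat 1 1) w v =
      conj (fderiv ℝ (fun p => (F p).mat 0 0) w v) := by
    simp only [← hconj, mat_apply_one_one]
  have h10 : fderiv ℝ (fun p => (F p).mat 1 0) w v =
      conj (fderiv ℝ (fun p => (F p).mat 0 1) w v) := by
    simp only [← hconj, mat_apply_one_zero]
  have hdet : fderiv ℝ (fun p => (F p).mat 0 0 * (F p).mat 1 1 - (F p).mat 0 1 * (F p).mat 1 0) w v
      = 0 := by
    simp only [← Matrix.det_fin_two, det_mat]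
    simp
  have hjacobi := (congrArg (fun L => L v)
    (((hd 0 0).mul (hd 1 1)).sub ((hd 0 1).mul (hd 1 0))).fderiv).symm.trans hdet
  simp only [sub_apply, add_apply,
    smul_apply, smul_eq_mul] at hjacobi
  constructor <;>
    simp only [leftMat, SLTilde.mat_inv, Matrix.adjugate_fin_two, matDeriv,
      Matrix.trace_fin_two, Matrix.mul_apply, Fin.sum_univ_two, Matrix.of_apply, Matrix.cons_val]
  · rw [h11, h10, mat_apply_one_one, mat_apply_one_zero]
    simp only [map_add, map_mul, map_neg, Complex.conj_conj]
    ring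
  · rw [h11, h10, mat_apply_one_one, mat_apply_one_zero]
    simp only [map_add, map_mul, map_neg, Complex.conj_conj]
    ring
  · linear_combination hjacobi

theorem secondLeftDeriv_sub_swap (hF : SmoothOn F D) (hD : IsOpen D) (hw : w ∈ D) (u v : ℂ) :
    secondLeftDeriv F w v u - secondLeftDeriv F w u v =
      bracket (leftDeriv F w u) (leftDeriv F w v) := by
  have hmat (i j) : ContDiffAt ℝ ∞ (fun p => (F p).mat i j) w :=
    (hF.contDiffOn_mat i j).contDiffAt (hD.mem_nhds hw)
  have hinv (i j) : DifferentiableAt ℝ (fun p => (F p)⁻¹.mat i j) w :=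
    ((hF.contDiffOn_mat_inv i j).contDiffAt (hD.mem_nhds hw)).differentiableAt (by simp)
  have hcoord (a b : ℂ) : secondLeftDeriv F w a b =
      coord (matDeriv (fun p => leftMat F p b) w a) :=
    fderiv_coord (fun i j => ((hF.contDiffOn_leftMat hD b i j).contDiffAt
      (hD.mem_nhds hw)).differentiableAt (by simp)) a
  have hMC := matDeriv_maurerCartan (fun p => mat_inv_mul (F p))
    (fun i j => (hmat i j).of_le (WithTop.coe_le_coe.2 (le_top : (2 : ℕ∞) ≤ ⊤))) hinv u v
  rw [hcoord, hcoord, ← coord_sub, bracket, leftDeriv_eq_coord_leftMat,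
    leftDeriv_eq_coord_leftMat, (hF.isSU11Lie_leftMat hD hw u).ofCoord_coord,
    (hF.isSU11Lie_leftMat hD hw v).ofCoord_coord]
  exact congrArg coord hMC

end SmoothOn

/-! ### Structure equations of a conformally parametrized surface -/

section StructureEquations

variable {F : ℂ → SLTilde} {D : Set ℂ} {w : ℂ}

namespace SmoothOn

theorem differentiableAt_leftDeriv (hF : SmoothOn F D) (hD : IsOpen D) (hw : w ∈ D) (v : ℂ)
    (k : Fin 3) : DifferentiableAt ℝ (fun p => leftDeriv F p v k) w :=
  ((hF.contDiffOn_leftDeriv hD v k).contDiffAt (hD.mem_nhds hw)).differentiableAt (by simp)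

theorem covDeriv_comm (hF : SmoothOn F D) (hD : IsOpen D) (hw : w ∈ D) (u v : ℂ) :
    covDeriv F w u v = covDeriv F w v u := by
  have hMC := hF.secondLeftDeriv_sub_swap hD hw u v
  rw [← nabla_sub_nabla_swap, sub_eq_sub_iff_add_eq_add] at hMC
  exact (add_comm _ _).trans hMC.symm

theorem fderiv_firstForm (hF : SmoothOn F D) (hD : IsOpen D) (hw : w ∈ D) (u a b : ℂ) :
    fderiv ℝ (fun p => firstForm F p a b) w u =
      covDeriv F w u a ⬝ᵥ leftDeriv F w b + leftDeriv F w a ⬝ᵥ covDeriv F w u b := by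
  have hd (v k) := (hF.differentiableAt_leftDeriv hD hw v k).hasFDerivAt
  have hproduct : fderiv ℝ (fun p => firstForm F p a b) w u =
      secondLeftDeriv F w u a ⬝ᵥ leftDeriv F w b + leftDeriv F w a ⬝ᵥ secondLeftDeriv F w u b := by
    refine (congrArg (fun L => L u) (HasFDerivAt.fun_sum (u := Finset.univ)
      fun k _ => (hd a k).mul (hd b k)).fderiv).trans ?_
    simp only [sum_apply, add_apply, smul_apply, smul_eq_mul, dotProduct, secondLeftDeriv,
      ← Finset.sum_add_distrib]
    exact Finset.sum_congr rfl fun k _ => by ring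
  have hmetric := nabla_dotProduct_comm (leftDeriv F w u) (leftDeriv F w a) (leftDeriv F w b)
  rw [hproduct]
  change _ = (secondLeftDeriv F w u a + _) ⬝ᵥ _ + _ ⬝ᵥ (secondLeftDeriv F w u b + _)
  rw [add_dotProduct, dotProduct_add, hmetric, dotProduct_comm (leftDeriv F w a) (nabla _ _)]
  ring

end SmoothOn

/-- `F` is a smooth conformal immersion of the open set `D`. -/
structure ConformalOn (F : ℂ → SLTilde) (D : Set ℂ) : Prop where
  isOpen : IsOpen D
  smoothOn : SmoothOn F D
  conformal : ∀ w ∈ D, 0 < firstForm F w 1 1 ∧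
    firstForm F w 1 1 = firstForm F w Complex.I Complex.I ∧ firstForm F w 1 Complex.I = 0

/-- The left translation of `∂F/∂x × ∂F/∂y`. -/
noncomputable def areaVector (F : ℂ → SLTilde) (w : ℂ) : Fin 3 → ℝ :=
  leftDeriv F w 1 ⨯₃ leftDeriv F w Complex.I

theorem areaVector_dotProduct_self (F : ℂ → SLTilde) (w : ℂ) :
    areaVector F w ⬝ᵥ areaVector F w = gramDet F w := by
  rw [areaVector, cross_dot_cross, dotProduct_comm (leftDeriv F w Complex.I) (leftDeriv F w 1),
    gramDet, sq]
  rfl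

theorem unitNormal_eq (F : ℂ → SLTilde) (w : ℂ) :
    unitNormal F w = (Real.sqrt (gramDet F w))⁻¹ • areaVector F w := by
  rw [← areaVector_dotProduct_self]
  rfl

theorem tangentSectionalAt_eq (h : 0 < gramDet F w) :
    tangentSectionalAt F w = 1 - 5 * unitNormal F w 2 ^ 2 := by
  have hself := areaVector_dotProduct_self F w
  have hne : areaVector F w ≠ 0 := fun h0 => by simp [h0, h.ne] at hself
  rw [tangentSectionalAt, sectional_eq_of_cross_ne_zero hne]
  change 1 - 5 * (areaVector F w 2 ^ 2 / (areaVector F w ⬝ᵥ areaVector F w)) = _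
  rw [hself, unitNormal_eq, Pi.smul_apply, smul_eq_mul, mul_pow, inv_pow, Real.sq_sqrt h.le,
    inv_mul_eq_div]

namespace ConformalOn

theorem mono (h : ConformalOn F D) {D' : Set ℂ} (hD' : IsOpen D') (hs : D' ⊆ D) :
    ConformalOn F D' :=
  ⟨hD', ContDiffOn.mono h.smoothOn hs, fun w hw => h.conformal w (hs hw)⟩

theorem gramDet_eq (h : ConformalOn F D) (hw : w ∈ D) : gramDet F w = firstForm F w 1 1 ^ 2 := by
  obtain ⟨-, hEG, hF⟩ := h.conformal w hw
  rw [gramDet, ← hEG, hF]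
  ring

theorem gramDet_pos (h : ConformalOn F D) (hw : w ∈ D) : 0 < gramDet F w := by
  rw [h.gramDet_eq hw]
  exact pow_pos (h.conformal w hw).1 2

theorem sqrt_gramDet (h : ConformalOn F D) (hw : w ∈ D) :
    Real.sqrt (gramDet F w) = firstForm F w 1 1 := by
  rw [h.gramDet_eq hw, Real.sqrt_sq (h.conformal w hw).1.le]

theorem fderiv_firstForm_one_one (h : ConformalOn F D) (hw : w ∈ D) (u : ℂ) :
    fderiv ℝ (fun p => firstForm F p 1 1) w u =
      fderiv ℝ (fun p => firstForm F p Complex.I Complex.I) w u := by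
  rw [Filter.EventuallyEq.fderiv_eq]
  filter_upwards [h.isOpen.mem_nhds hw] with p hp using (h.conformal p hp).2.1

theorem fderiv_firstForm_one_I (h : ConformalOn F D) (hw : w ∈ D) (u : ℂ) :
    fderiv ℝ (fun p => firstForm F p 1 Complex.I) w u = 0 := by
  have hzero : (fun p => firstForm F p 1 Complex.I) =ᶠ[nhds w] fun _ => 0 := by
    filter_upwards [h.isOpen.mem_nhds hw] with p hp using (h.conformal p hp).2.2
  rw [hzero.fderiv_eq]
  simp

theorem leftDeriv_dotProduct_tension (h : ConformalOn F D) (hw : w ∈ D) :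
    leftDeriv F w 1 ⬝ᵥ (covDeriv F w 1 1 + covDeriv F w Complex.I Complex.I) = 0 ∧
      leftDeriv F w Complex.I ⬝ᵥ (covDeriv F w 1 1 + covDeriv F w Complex.I Complex.I) = 0 := by
  have hEG := h.fderiv_firstForm_one_one hw
  have hF := h.fderiv_firstForm_one_I hw
  simp only [h.smoothOn.fderiv_firstForm h.isOpen hw] at hEG hF
  have hEG_x := hEG 1
  have hEG_y := hEG Complex.I
  have hF_x := hF 1
  have hF_y := hF Complex.I
  rw [h.smoothOn.covDeriv_comm h.isOpen hw Complex.I 1] at hEG_y hF_y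
  simp only [dotProduct_add, dotProduct_comm (covDeriv F w _ _)] at hEG_x hEG_y hF_x hF_y ⊢
  constructor <;> linarith

theorem meanCurvatureAt_eq (h : ConformalOn F D) (hw : w ∈ D) : meanCurvatureAt F w =
    (covDeriv F w 1 1 + covDeriv F w Complex.I Complex.I) ⬝ᵥ areaVector F w /
      (2 * firstForm F w 1 1 ^ 2) := by
  obtain ⟨hpos, hEG, hF⟩ := h.conformal w hw
  simp only [meanCurvatureAt, secondForm]
  rw [← hEG, hF, h.gramDet_eq hw, unitNormal_eq, h.sqrt_gramDet hw, add_dotProduct]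
  simp only [dotProduct_smul, smul_eq_mul]
  field_simp
  ring

theorem tension_eq (h : ConformalOn F D) (hw : w ∈ D) :
    covDeriv F w 1 1 + covDeriv F w Complex.I Complex.I =
      (2 * meanCurvatureAt F w) • areaVector F w := by
  obtain ⟨hx, hy⟩ := h.leftDeriv_dotProduct_tension hw
  have hnormal := smul_eq_smul_cross_of_orthogonal hx hy
  change (areaVector F w ⬝ᵥ areaVector F w) • _ = (_ ⬝ᵥ areaVector F w) • areaVector F w at hnormal
  have hpos := (h.conformal w hw).1
  rw [areaVector_dotProduct_self, h.gramDet_eq hw] at hnormal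
  rw [h.meanCurvatureAt_eq hw, ← mul_div_assoc, mul_div_mul_left _ _ two_ne_zero, div_eq_inv_mul,
    mul_smul, ← hnormal, inv_smul_smul₀ (pow_pos hpos 2).ne']

end ConformalOn

theorem SmoothOn.dzbar_zCoord (hF : SmoothOn F D) (hD : IsOpen D) (hw : w ∈ D) (k : Fin 3) :
    dzbar (fun p => zCoord F p k) w =
      ((secondLeftDeriv F w 1 1 + secondLeftDeriv F w Complex.I Complex.I) k +
        Complex.I * (secondLeftDeriv F w Complex.I 1 - secondLeftDeriv F w 1 Complex.I) k) / 4 := by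
  have hd (v) : HasFDerivAt (fun p => (leftDeriv F p v k : ℂ))
      (Complex.ofRealCLM ∘L fderiv ℝ (fun p => leftDeriv F p v k) w) w :=
    Complex.ofRealCLM.hasFDerivAt.comp w (hF.differentiableAt_leftDeriv hD hw v k).hasFDerivAt
  have hfderiv (u : ℂ) : fderiv ℝ (fun p => zCoord F p k) w u =
      ((secondLeftDeriv F w u 1 k : ℂ) -
        Complex.I * (secondLeftDeriv F w u Complex.I k : ℂ)) * (1 / 2) := by
    have hZ : (fun p => zCoord F p k) = fun p => ((leftDeriv F p 1 k : ℂ) -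
        Complex.I * (leftDeriv F p Complex.I k : ℂ)) * (1 / 2) := by
      ext p
      rw [zCoord, div_eq_mul_one_div]
    rw [hZ]
    refine (congrArg (fun L : ℂ →L[ℝ] ℂ => L u)
      (((hd 1).sub ((hd Complex.I).const_mul Complex.I)).mul_const (1 / 2 : ℂ)).fderiv).trans ?_
    simp [secondLeftDeriv]
    ring
  rw [dzbar, hfderiv, hfderiv]
  simp only [Pi.add_apply, Pi.sub_apply, Complex.ofReal_add, Complex.ofReal_sub]
  linear_combination -(secondLeftDeriv F w Complex.I Complex.I k : ℂ) * Complex.I_mul_I / 4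

theorem ConformalOn.dzbar_zCoord (h : ConformalOn F D) (hw : w ∈ D) (k : Fin 3) :
    dzbar (fun p => zCoord F p k) w = (meanCurvatureAt F w - Complex.I) / 2 * areaVector F w k -
      5 / 2 * conj (zCoord F w 2) * (![-zCoord F w 1, zCoord F w 0, 0] : Fin 3 → ℂ) k := by
  set X := leftDeriv F w 1 with hX
  set Y := leftDeriv F w Complex.I with hY
  have hsum : (secondLeftDeriv F w 1 1 + secondLeftDeriv F w Complex.I Complex.I) k =
      2 * meanCurvatureAt F w * areaVector F w k - nabla X X k - nabla Y Y k := by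
    have htension : secondLeftDeriv F w 1 1 k + nabla X X k +
        (secondLeftDeriv F w Complex.I Complex.I k + nabla Y Y k) =
          2 * meanCurvatureAt F w * areaVector F w k := congrFun (h.tension_eq hw) k
    rw [Pi.add_apply]
    linarith
  have hconj : conj (zCoord F w 2) = ((X 2 : ℂ) + Complex.I * (Y 2 : ℂ)) / 2 := by
    simp [zCoord, map_ofNat, hX, hY]
  rw [h.smoothOn.dzbar_zCoord h.isOpen hw, hsum, h.smoothOn.secondLeftDeriv_sub_swap h.isOpen hw,
    hconj, nabla_apply, nabla_apply, bracket_apply, areaVector, cross_apply]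
  have hI := Complex.I_mul_I
  fin_cases k <;> simp [zCoord, ← hX, ← hY]
  · linear_combination (5 / 8 * (Y 1 : ℂ) * (Y 2 : ℂ)) * hI
  · linear_combination (-5 / 8 * (Y 0 : ℂ) * (Y 2 : ℂ)) * hI
  · ring

end StructureEquations

/-! ### Generating spinors and Dirac potentials -/

section Wirtinger

variable {g h : ℂ → ℂ} {w : ℂ}

theorem dzbar_const_mul_add_const_mul (hg : DifferentiableAt ℝ g w) (hh : DifferentiableAt ℝ h w)
    (a b : ℂ) : dzbar (fun p => a * g p + b * h p) w = a * dzbar g w + b * dzbar h w := by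
  have hderiv := ((hg.hasFDerivAt.const_mul a).add (hh.hasFDerivAt.const_mul b)).fderiv
  refine (congrArg (fun L : ℂ →L[ℝ] ℂ => (L 1 + Complex.I * L Complex.I) / 2) hderiv).trans ?_
  simp only [dzbar, add_apply, smul_apply, smul_eq_mul]
  ring

theorem dzbar_sq (hg : DifferentiableAt ℝ g w) :
    dzbar (fun p => g p ^ 2) w = 2 * g w * dzbar g w := by
  refine (congrArg (fun L : ℂ →L[ℝ] ℂ => (L 1 + Complex.I * L Complex.I) / 2)
    (hg.hasFDerivAt.pow 2).fderiv).trans ?_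
  simp only [dzbar, smul_apply, smul_eq_mul]
  ring

theorem dzbar_conj (g : ℂ → ℂ) (w : ℂ) : dzbar (fun p => conj (g p)) w = conj (dz g w) := by
  have hconj : fderiv ℝ (fun p => conj (g p)) w = _ := Complex.conjCLE.comp_fderiv
  rw [dzbar, hconj, dz]
  simp [map_ofNat]

end Wirtinger

section Spinors

variable {F : ℂ → SLTilde} {D : Set ℂ} {w : ℂ} {ψ₁ ψ₂ U V : ℂ → ℂ}

/-- The combinations `-i Z₁ ± Z₂` of the coordinates of `F⁻¹ ∂F`, with `ε = ±1`. For a generating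
spinor they are `ψ₁²` (`ε = -1`) and `ψ̄₂²` (`ε = 1`). -/
noncomputable def nullCoord (F : ℂ → SLTilde) (ε : ℂ) (w : ℂ) : ℂ :=
  -Complex.I * zCoord F w 0 + ε * zCoord F w 1

theorem isGeneratingSpinor_iff : IsGeneratingSpinor F D ψ₁ ψ₂ ↔
    ContDiffOn ℝ ∞ ψ₁ D ∧ ContDiffOn ℝ ∞ ψ₂ D ∧ ∀ w ∈ D,
      ψ₁ w ^ 2 = nullCoord F (-1) w ∧ conj (ψ₂ w) ^ 2 = nullCoord F 1 w ∧
        ψ₁ w * conj (ψ₂ w) = zCoord F w 2 := by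
  refine and_congr_right' (and_congr_right' (forall₂_congr fun w _ => ?_))
  simp only [nullCoord]
  have hI := Complex.I_sq
  constructor
  · rintro ⟨h0, h1, h2⟩
    rw [h0, h1]
    exact ⟨by linear_combination (conj (ψ₂ w) ^ 2 + ψ₁ w ^ 2) / 2 * hI,
      by linear_combination (conj (ψ₂ w) ^ 2 + ψ₁ w ^ 2) / 2 * hI, h2.symm⟩
  · rintro ⟨h0, h1, h2⟩
    rw [h0, h1]
    exact ⟨by linear_combination zCoord F w 0 * hI, by ring, h2.symm⟩

theorem ofReal_areaVector (F : ℂ → SLTilde) (w : ℂ) (k : Fin 3) : (areaVector F w k : ℂ) =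
    -2 * Complex.I * (zCoord F w ⨯₃ fun j => conj (zCoord F w j)) k := by
  have hI := Complex.I_sq
  set X := leftDeriv F w 1 with hX
  set Y := leftDeriv F w Complex.I with hY
  rw [areaVector, cross_apply, cross_apply]
  fin_cases k <;> simp [zCoord, map_ofNat, ← hX, ← hY]
  · linear_combination ((X 1 * Y 2 : ℂ) - X 2 * Y 1) * hI
  · linear_combination ((X 2 * Y 0 : ℂ) - X 0 * Y 2) * hI
  · linear_combination ((X 0 * Y 1 : ℂ) - X 1 * Y 0) * hI

theorem SmoothOn.contDiffOn_zCoord (hF : SmoothOn F D) (hD : IsOpen D) (k : Fin 3) :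
    ContDiffOn ℝ ∞ (fun p => zCoord F p k) D := by
  have hofReal (v) : ContDiffOn ℝ ∞ (fun p => (leftDeriv F p v k : ℂ)) D :=
    Complex.ofRealCLM.contDiff.comp_contDiffOn (hF.contDiffOn_leftDeriv hD v k)
  exact ((hofReal 1).sub (contDiffOn_const.mul (hofReal Complex.I))).div_const 2

theorem SmoothOn.contDiffOn_nullCoord (hF : SmoothOn F D) (hD : IsOpen D) (ε : ℂ) :
    ContDiffOn ℝ ∞ (nullCoord F ε) D :=
  (contDiffOn_const.mul (hF.contDiffOn_zCoord hD 0)).add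
    (contDiffOn_const.mul (hF.contDiffOn_zCoord hD 1))

namespace ConformalOn

theorem nullCoord_mul_nullCoord (h : ConformalOn F D) (hw : w ∈ D) :
    nullCoord F (-1) w * nullCoord F 1 w = zCoord F w 2 ^ 2 := by
  obtain ⟨-, hEG, hF⟩ := h.conformal w hw
  have hEG' := congrArg (fun t : ℝ => (t : ℂ)) hEG
  have hF' := congrArg (fun t : ℝ => (t : ℂ)) hF
  simp only [firstForm, dotProduct, Fin.sum_univ_three, Complex.ofReal_add, Complex.ofReal_mul,
    Complex.ofReal_zero] at hEG' hF'
  have hnull : zCoord F w 0 ^ 2 + zCoord F w 1 ^ 2 + zCoord F w 2 ^ 2 = 0 := by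
    simp only [zCoord]
    linear_combination hEG' / 4 - Complex.I / 2 * hF' + ((leftDeriv F w Complex.I 0 : ℂ) ^ 2 +
      (leftDeriv F w Complex.I 1 : ℂ) ^ 2 + (leftDeriv F w Complex.I 2 : ℂ) ^ 2) / 4 * Complex.I_sq
  simp only [nullCoord]
  linear_combination zCoord F w 0 ^ 2 * Complex.I_sq - hnull

theorem ofReal_firstForm (h : ConformalOn F D) (hw : w ∈ D) : (firstForm F w 1 1 : ℂ) =
    2 * (zCoord F w ⬝ᵥ fun j => conj (zCoord F w j)) := by
  obtain ⟨-, hEG, -⟩ := h.conformal w hw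
  have hEG' := congrArg (fun t : ℝ => (t : ℂ)) hEG
  simp only [firstForm, dotProduct, Fin.sum_univ_three, Complex.ofReal_add,
    Complex.ofReal_mul] at hEG'
  simp only [zCoord, firstForm, dotProduct, Fin.sum_univ_three, map_div₀, map_sub, map_mul,
    Complex.conj_ofReal, Complex.conj_I, map_ofNat, Complex.ofReal_add, Complex.ofReal_mul]
  linear_combination hEG' / 2 + ((leftDeriv F w Complex.I 0 : ℂ) ^ 2 +
    (leftDeriv F w Complex.I 1 : ℂ) ^ 2 + (leftDeriv F w Complex.I 2 : ℂ) ^ 2) / 2 * Complex.I_sq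

theorem dzbar_nullCoord (h : ConformalOn F D) (hw : w ∈ D) {ε : ℂ} (hε : ε ^ 2 = 1) :
    dzbar (nullCoord F ε) w =
      (meanCurvatureAt F w - Complex.I) / 2 * (-Complex.I * areaVector F w 0 + ε * areaVector F w 1)
        - 5 / 2 * ε * Complex.I * conj (zCoord F w 2) * nullCoord F ε w := by
  have hd (k) : DifferentiableAt ℝ (fun p => zCoord F p k) w :=
    ((h.smoothOn.contDiffOn_zCoord h.isOpen k).contDiffAt
      (h.isOpen.mem_nhds hw)).differentiableAt (by simp)
  refine (dzbar_const_mul_add_const_mul (hd 0) (hd 1) _ _).trans ?_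
  rw [h.dzbar_zCoord hw, h.dzbar_zCoord hw, nullCoord]
  simp only [Matrix.cons_val]
  linear_combination 5 / 2 * conj (zCoord F w 2) *
    (Complex.I * zCoord F w 1 * hε - ε * zCoord F w 0 * Complex.I_sq)

theorem firstForm_of_spinor (h : ConformalOn F D) (hψ : IsGeneratingSpinor F D ψ₁ ψ₂)
    (hw : w ∈ D) :
    firstForm F w 1 1 = (Complex.normSq (ψ₁ w) + Complex.normSq (ψ₂ w)) ^ 2 := by
  obtain ⟨h0, h1, h2⟩ := hψ.2.2 w hw
  apply Complex.ofReal_injective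
  rw [h.ofReal_firstForm hw]
  simp only [dotProduct, Fin.sum_univ_three, h0, h1, h2, map_mul, map_add, map_sub, map_pow,
    map_div₀, map_one, map_ofNat, Complex.conj_I, Complex.conj_conj, Complex.ofReal_pow,
    Complex.ofReal_add, ← Complex.mul_conj]
  linear_combination
    (-(conj (ψ₂ w) ^ 2 + ψ₁ w ^ 2) * (ψ₂ w ^ 2 + conj (ψ₁ w) ^ 2) / 2) * Complex.I_sq

end ConformalOn

theorem areaVector_of_spinor (hψ : IsGeneratingSpinor F D ψ₁ ψ₂) (hw : w ∈ D) :
    -Complex.I * areaVector F w 0 - areaVector F w 1 =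
        2 * (Complex.normSq (ψ₁ w) + Complex.normSq (ψ₂ w)) * (ψ₁ w * ψ₂ w) ∧
      areaVector F w 2 = (Complex.normSq (ψ₂ w) - Complex.normSq (ψ₁ w)) *
        (Complex.normSq (ψ₁ w) + Complex.normSq (ψ₂ w)) := by
  obtain ⟨h0, h1, h2⟩ := hψ.2.2 w hw
  refine ⟨?_, Complex.ofReal_injective ?_⟩ <;>
    simp only [ofReal_areaVector, cross_apply, Matrix.cons_val, h0, h1, h2, map_mul, map_add,
      map_sub, map_pow, map_div₀, map_one, map_ofNat, Complex.conj_I, Complex.conj_conj,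
      Complex.ofReal_mul, Complex.ofReal_add, Complex.ofReal_sub, ← Complex.mul_conj]
  · linear_combination (-2 * (ψ₁ w * conj (ψ₁ w) + ψ₂ w * conj (ψ₂ w)) * (ψ₁ w * ψ₂ w)) *
      Complex.I_sq
  · linear_combination ((ψ₁ w * conj (ψ₁ w)) ^ 2 - (ψ₂ w * conj (ψ₂ w)) ^ 2) * Complex.I_sq

/-- The Dirac potential `U` of a generating spinor. -/
noncomputable def potentialU (F : ℂ → SLTilde) (ψ₁ ψ₂ : ℂ → ℂ) (w : ℂ) : ℂ :=
  (meanCurvatureAt F w / 2 * (Complex.normSq (ψ₁ w) + Complex.normSq (ψ₂ w)) : ℝ) +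
    Complex.I * (1 / 2 * Complex.normSq (ψ₁ w) - 3 / 4 * Complex.normSq (ψ₂ w) : ℝ)

/-- The Dirac potential `V` of a generating spinor. -/
noncomputable def potentialV (F : ℂ → SLTilde) (ψ₁ ψ₂ : ℂ → ℂ) (w : ℂ) : ℂ :=
  (meanCurvatureAt F w / 2 * (Complex.normSq (ψ₁ w) + Complex.normSq (ψ₂ w)) : ℝ) +
    Complex.I * (3 / 4 * Complex.normSq (ψ₁ w) - 1 / 2 * Complex.normSq (ψ₂ w) : ℝ)

/-- The density with respect to the area of the 2-form `U V dx ∧ dy`. -/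
noncomputable def energyDensityAt (F : ℂ → SLTilde) (w : ℂ) : ℂ :=
  (1 / 4 * (meanCurvatureAt F w ^ 2 + 5 / 16 * tangentSectionalAt F w - 1 / 4) : ℝ) -
    Complex.I * (5 / 8 * (meanCurvatureAt F w * unitNormal F w 2) : ℝ)

namespace ConformalOn

theorem unitNormal_of_spinor (h : ConformalOn F D) (hψ : IsGeneratingSpinor F D ψ₁ ψ₂)
    (hw : w ∈ D) : unitNormal F w 2 * (Complex.normSq (ψ₁ w) + Complex.normSq (ψ₂ w)) =
      Complex.normSq (ψ₂ w) - Complex.normSq (ψ₁ w) := by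
  have hpos := (h.conformal w hw).1
  rw [h.firstForm_of_spinor hψ hw] at hpos
  have hne := (pow_ne_zero_iff two_ne_zero).1 hpos.ne'
  rw [unitNormal_eq, h.sqrt_gramDet hw, h.firstForm_of_spinor hψ hw, Pi.smul_apply, smul_eq_mul,
    (areaVector_of_spinor hψ hw).2]
  field_simp

theorem potentialU_mul_potentialV (h : ConformalOn F D) (hψ : IsGeneratingSpinor F D ψ₁ ψ₂)
    (hw : w ∈ D) : potentialU F ψ₁ ψ₂ w * potentialV F ψ₁ ψ₂ w =
      firstForm F w 1 1 * energyDensityAt F w := by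
  have hn := congrArg (fun t : ℝ => (t : ℂ)) (h.unitNormal_of_spinor hψ hw)
  rw [energyDensityAt, tangentSectionalAt_eq (h.gramDet_pos hw), h.firstForm_of_spinor hψ hw,
    potentialU, potentialV]
  set H := meanCurvatureAt F w
  set n := unitNormal F w 2
  set p := Complex.normSq (ψ₁ w)
  set q := Complex.normSq (ψ₂ w)
  push_cast at hn ⊢
  linear_combination (25 / 64 * (n * (p + q) + (q - p)) + 5 / 8 * Complex.I * H * (p + q)) * hn +
    (p / 2 - 3 / 4 * q : ℂ) * (3 / 4 * p - q / 2) * Complex.I_sq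

theorem mul_dzbar_of_spinor (h : ConformalOn F D) (hψ : IsGeneratingSpinor F D ψ₁ ψ₂)
    (hw : w ∈ D) : ψ₁ w * dzbar ψ₁ w = ψ₁ w * (potentialV F ψ₁ ψ₂ w * ψ₂ w) := by
  have hnhds := h.isOpen.mem_nhds hw
  have hsq : (fun p => ψ₁ p ^ 2) =ᶠ[nhds w] nullCoord F (-1) := by
    filter_upwards [hnhds] with p hp using ((isGeneratingSpinor_iff.1 hψ).2.2 p hp).1
  have hleft := dzbar_sq ((hψ.1.contDiffAt hnhds).differentiableAt (by simp))
  have hright := h.dzbar_nullCoord hw (ε := -1) (by norm_num)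
  rw [dzbar, hsq.fderiv_eq, ← dzbar, hright, neg_one_mul, ← sub_eq_add_neg,
    (areaVector_of_spinor hψ hw).1, ← hsq.eq_of_nhds, (hψ.2.2 w hw).2.2, map_mul,
    Complex.conj_conj] at hleft
  have hnorm := Complex.mul_conj (ψ₁ w)
  rw [potentialV]
  push_cast
  linear_combination -hleft / 2 + 5 / 4 * Complex.I * ψ₁ w * ψ₂ w * hnorm

theorem mul_dz_of_spinor (h : ConformalOn F D) (hψ : IsGeneratingSpinor F D ψ₁ ψ₂)
    (hw : w ∈ D) : ψ₂ w * dz ψ₂ w = -(ψ₂ w * (potentialU F ψ₁ ψ₂ w * ψ₁ w)) := by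
  have hnhds := h.isOpen.mem_nhds hw
  have hsq : (fun p => conj (ψ₂ p) ^ 2) =ᶠ[nhds w] nullCoord F 1 := by
    filter_upwards [hnhds] with p hp using ((isGeneratingSpinor_iff.1 hψ).2.2 p hp).2.1
  have hleft := dzbar_sq (g := fun p => conj (ψ₂ p)) (Complex.conjCLE.differentiableAt.comp w
    ((hψ.2.1.contDiffAt hnhds).differentiableAt (by simp)))
  have hright := h.dzbar_nullCoord hw (ε := 1) (by norm_num)
  rw [dzbar_conj, dzbar, hsq.fderiv_eq, ← dzbar, hright, ← hsq.eq_of_nhds, (hψ.2.2 w hw).2.2,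
    map_mul, Complex.conj_conj] at hleft
  have hleft' := congrArg conj hleft
  simp only [map_mul, map_add, map_sub, map_div₀, map_neg, map_one, map_pow, map_ofNat,
    Complex.conj_ofReal, Complex.conj_I, Complex.conj_conj] at hleft'
  have harea := (areaVector_of_spinor hψ hw).1
  have hnorm := Complex.mul_conj (ψ₂ w)
  rw [potentialU]
  push_cast
  linear_combination -hleft' / 2 - (meanCurvatureAt F w + Complex.I) / 4 * harea +
    5 / 4 * Complex.I * ψ₁ w * ψ₂ w * hnorm

end ConformalOn

end Spinors

/-! ### Existence and uniqueness of spinors and potentials -/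

section Continuity

variable {F : ℂ → SLTilde} {D : Set ℂ}

theorem continuousOn_nabla {X : Type*} [TopologicalSpace X] {s : Set X} {a b : X → Fin 3 → ℝ}
    (ha : ContinuousOn a s) (hb : ContinuousOn b s) :
    ContinuousOn (fun x => nabla (a x) (b x)) s := by
  unfold nabla
  fun_prop

theorem continuousOn_cross {X : Type*} [TopologicalSpace X] {s : Set X} {a b : X → Fin 3 → ℝ}
    (ha : ContinuousOn a s) (hb : ContinuousOn b s) :
    ContinuousOn (fun x => a x ⨯₃ b x) s := by
  simp only [cross_apply]
  fun_prop

namespace SmoothOn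

theorem continuousOn_leftDeriv (hF : SmoothOn F D) (hD : IsOpen D) (v : ℂ) :
    ContinuousOn (fun w => leftDeriv F w v) D :=
  continuousOn_pi.2 fun k => (hF.contDiffOn_leftDeriv hD v k).continuousOn

theorem continuousOn_firstForm (hF : SmoothOn F D) (hD : IsOpen D) (u v : ℂ) :
    ContinuousOn (fun w => firstForm F w u v) D := by
  have hu := hF.continuousOn_leftDeriv hD u
  have hv := hF.continuousOn_leftDeriv hD v
  simp only [firstForm, dotProduct]
  fun_prop

theorem continuousOn_areaVector (hF : SmoothOn F D) (hD : IsOpen D) :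
    ContinuousOn (areaVector F) D :=
  continuousOn_cross (hF.continuousOn_leftDeriv hD 1) (hF.continuousOn_leftDeriv hD Complex.I)

theorem continuousOn_covDeriv (hF : SmoothOn F D) (hD : IsOpen D) (u v : ℂ) :
    ContinuousOn (fun w => covDeriv F w u v) D := by
  have hsecond (k : Fin 3) : ContinuousOn (fun w => secondLeftDeriv F w u v k) D :=
    ((hF.contDiffOn_leftDeriv hD v k).continuousOn_fderiv_of_isOpen hD (by simp)).clm_apply
      continuousOn_const
  have hnabla : ContinuousOn (fun w => nabla (leftDeriv F w u) (leftDeriv F w v)) D :=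
    continuousOn_nabla (hF.continuousOn_leftDeriv hD u) (hF.continuousOn_leftDeriv hD v)
  exact continuousOn_pi.2 fun k => (hsecond k).add (continuousOn_pi.1 hnabla k)

end SmoothOn

namespace ConformalOn

theorem continuousOn_meanCurvatureAt (h : ConformalOn F D) :
    ContinuousOn (meanCurvatureAt F) D := by
  refine ContinuousOn.congr (ContinuousOn.div ?_ ?_ fun w hw => ?_)
    fun w hw => h.meanCurvatureAt_eq hw
  · have hxx := h.smoothOn.continuousOn_covDeriv h.isOpen 1 1
    have hyy := h.smoothOn.continuousOn_covDeriv h.isOpen Complex.I Complex.I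
    have harea := h.smoothOn.continuousOn_areaVector h.isOpen
    simp only [dotProduct]
    fun_prop
  · exact continuousOn_const.mul ((h.smoothOn.continuousOn_firstForm h.isOpen 1 1).pow 2)
  · exact mul_ne_zero two_ne_zero (pow_ne_zero 2 (h.conformal w hw).1.ne')

theorem continuousOn_unitNormal (h : ConformalOn F D) : ContinuousOn (unitNormal F) D := by
  refine ContinuousOn.congr (f := fun w => (firstForm F w 1 1)⁻¹ • areaVector F w) ?_
    fun w hw => by rw [unitNormal_eq, h.sqrt_gramDet hw]
  exact ((h.smoothOn.continuousOn_firstForm h.isOpen 1 1).inv₀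
    fun w hw => (h.conformal w hw).1.ne').smul (h.smoothOn.continuousOn_areaVector h.isOpen)

theorem continuousOn_tangentSectionalAt (h : ConformalOn F D) :
    ContinuousOn (tangentSectionalAt F) D := by
  have hN := h.continuousOn_unitNormal
  refine ContinuousOn.congr (f := fun w => 1 - 5 * unitNormal F w 2 ^ 2) (by fun_prop)
    fun _ hw => tangentSectionalAt_eq (h.gramDet_pos hw)

theorem continuousOn_energyDensityAt (h : ConformalOn F D) :
    ContinuousOn (energyDensityAt F) D := by
  have hH := h.continuousOn_meanCurvatureAt
  have hK := h.continuousOn_tangentSectionalAt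
  have hN := h.continuousOn_unitNormal
  unfold energyDensityAt
  fun_prop

end ConformalOn

end Continuity

section Potentials

variable {F : ℂ → SLTilde} {D : Set ℂ} {w : ℂ} {ψ₁ ψ₂ U V : ℂ → ℂ}

theorem continuousOn_dz {g : ℂ → ℂ} (hD : IsOpen D) (hg : ContDiffOn ℝ ∞ g D) :
    ContinuousOn (dz g) D := by
  have hg' := (hg.fderiv_of_isOpen (m := ∞) hD (by simp)).continuousOn
  unfold dz
  fun_prop

theorem continuousOn_dzbar {g : ℂ → ℂ} (hD : IsOpen D) (hg : ContDiffOn ℝ ∞ g D) :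
    ContinuousOn (dzbar g) D := by
  have hg' := (hg.fderiv_of_isOpen (m := ∞) hD (by simp)).continuousOn
  unfold dzbar
  fun_prop

namespace ConformalOn

/- The planes spanned by `e₁, e₂` form a contact distribution, so that no piece of a surface is
tangent to it. -/
theorem subset_closure_zCoord_ne_zero (h : ConformalOn F D) :
    D ⊆ closure {p ∈ D | zCoord F p 2 ≠ 0} := by
  intro w hw
  by_contra hcl
  have hzero : (fun p => zCoord F p 2) =ᶠ[nhds w] fun _ => 0 := by
    filter_upwards [h.isOpen.mem_nhds hw, isClosed_closure.isOpen_compl.mem_nhds hcl] with p hp hp'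
    by_contra hne
    exact hp' (subset_closure ⟨hp, hne⟩)
  have hderiv := h.dzbar_zCoord hw 2
  have hH : ((meanCurvatureAt F w : ℂ) - Complex.I) / 2 ≠ 0 := fun h0 => by
    simpa using congrArg Complex.im h0
  have harea : areaVector F w 2 = 0 := by
    rw [dzbar, hzero.fderiv_eq] at hderiv
    simpa [hH] using hderiv.symm
  have hx : leftDeriv F w 1 2 = 0 := by simpa [zCoord] using congrArg Complex.re hzero.eq_of_nhds
  have hy : leftDeriv F w Complex.I 2 = 0 := by
    simpa [zCoord] using congrArg Complex.im hzero.eq_of_nhds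
  have hself := areaVector_dotProduct_self F w
  have hpos := h.gramDet_pos hw
  rw [← hself, dotProduct, Fin.sum_univ_three, harea] at hpos
  simp [areaVector, cross_apply, hx, hy] at hpos

theorem eqOn_of_eqOn_spinor_ne_zero (h : ConformalOn F D) (hψ : IsGeneratingSpinor F D ψ₁ ψ₂)
    {a b : ℂ → ℂ} (ha : ContinuousOn a D) (hb : ContinuousOn b D)
    (hab : ∀ w ∈ D, ψ₁ w ≠ 0 → ψ₂ w ≠ 0 → a w = b w) : Set.EqOn a b D := by
  refine Set.EqOn.of_subset_closure (s := {p ∈ D | zCoord F p 2 ≠ 0}) (fun p ⟨hp, hne⟩ => ?_)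
    ha hb (Set.sep_subset _ _) h.subset_closure_zCoord_ne_zero
  rw [(hψ.2.2 p hp).2.2] at hne
  exact hab p hp (left_ne_zero_of_mul hne) fun h0 => hne (by rw [h0, map_zero, mul_zero])

theorem isDiracPotential (h : ConformalOn F D) (hψ : IsGeneratingSpinor F D ψ₁ ψ₂) :
    IsDiracPotential D ψ₁ ψ₂ (potentialU F ψ₁ ψ₂) (potentialV F ψ₁ ψ₂) := by
  have hH := h.continuousOn_meanCurvatureAt
  have hψ₁ := hψ.1.continuousOn
  have hψ₂ := hψ.2.1.continuousOn
  have hnorm₁ := Complex.continuous_normSq.comp_continuousOn hψ₁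
  have hnorm₂ := Complex.continuous_normSq.comp_continuousOn hψ₂
  have hU : ContinuousOn (potentialU F ψ₁ ψ₂) D := by
    unfold potentialU
    fun_prop
  have hV : ContinuousOn (potentialV F ψ₁ ψ₂) D := by
    unfold potentialV
    fun_prop
  have hdz : Set.EqOn (dz ψ₂) (-(potentialU F ψ₁ ψ₂ * ψ₁)) D :=
    h.eqOn_of_eqOn_spinor_ne_zero hψ (continuousOn_dz h.isOpen hψ.2.1) (hU.mul hψ₁).neg
      fun p hp _ hne => mul_left_cancel₀ hne ((h.mul_dz_of_spinor hψ hp).trans (mul_neg _ _).symm)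
  have hdzbar : Set.EqOn (dzbar ψ₁) (potentialV F ψ₁ ψ₂ * ψ₂) D :=
    h.eqOn_of_eqOn_spinor_ne_zero hψ (continuousOn_dzbar h.isOpen hψ.1) (hV.mul hψ₂)
      fun p hp hne _ => mul_left_cancel₀ hne (h.mul_dzbar_of_spinor hψ hp)
  refine ⟨hU, hV, fun p hp => ⟨?_, ?_⟩⟩
  · simp [hdz hp]
  · simp [hdzbar hp]

theorem diracPotential_unique (h : ConformalOn F D) (hψ : IsGeneratingSpinor F D ψ₁ ψ₂)
    {U' V' : ℂ → ℂ} (hUV : IsDiracPotential D ψ₁ ψ₂ U V) (hUV' : IsDiracPotential D ψ₁ ψ₂ U' V') :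
    Set.EqOn U U' D ∧ Set.EqOn V V' D := by
  constructor
  · refine h.eqOn_of_eqOn_spinor_ne_zero hψ hUV.1 hUV'.1 fun p hp hne _ =>
      mul_right_cancel₀ hne ?_
    linear_combination (hUV.2.2 p hp).1 - (hUV'.2.2 p hp).1
  · refine h.eqOn_of_eqOn_spinor_ne_zero hψ hUV.2.1 hUV'.2.1 fun p hp _ hne =>
      mul_right_cancel₀ hne ?_
    linear_combination (hUV.2.2 p hp).2 - (hUV'.2.2 p hp).2

theorem diracPotential_mul (h : ConformalOn F D) (hψ : IsGeneratingSpinor F D ψ₁ ψ₂)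
    (hUV : IsDiracPotential D ψ₁ ψ₂ U V) (hw : w ∈ D) :
    U w * V w = firstForm F w 1 1 * energyDensityAt F w := by
  obtain ⟨hU, hV⟩ := h.diracPotential_unique hψ hUV (h.isDiracPotential hψ)
  rw [hU hw, hV hw, h.potentialU_mul_potentialV hψ hw]

end ConformalOn

end Potentials

section SquareRoots

variable {E : Type*} [NormedAddCommGroup E] [NormedSpace ℝ E] {D : Set E} {w : E} {A B C : E → ℂ}

theorem exists_contDiffOn_sqrt (hD : IsOpen D) (hA : ContDiffOn ℝ ∞ A D) (hw : w ∈ D)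
    (h0 : A w ≠ 0) : ∃ D' ⊆ D, IsOpen D' ∧ w ∈ D' ∧ ∃ χ : E → ℂ, ContDiffOn ℝ ∞ χ D' ∧
      ∀ p ∈ D', χ p ≠ 0 ∧ χ p ^ 2 = A p := by
  obtain ⟨c, hc⟩ := IsAlgClosed.exists_pow_nat_eq (A w) two_pos
  have hquot : ContDiffOn ℝ ∞ (fun p => A p / A w) D := hA.div_const _
  refine ⟨D ∩ (fun p => A p / A w) ⁻¹' Complex.slitPlane, Set.inter_subset_left,
    hquot.continuousOn.isOpen_inter_preimage hD Complex.isOpen_slitPlane, ⟨hw, ?_⟩,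
    fun p => c * Complex.exp (Complex.log (A p / A w) / 2), ?_, ?_⟩
  · simp [div_self h0]
  · refine contDiffOn_const.mul (ContDiffOn.cexp (ContDiffOn.div_const ?_ 2))
    intro p hp
    have hlog : ContDiffAt ℝ ∞ Complex.log (A p / A w) :=
      (Complex.contDiffAt_log (n := ∞) hp.2).restrict_scalars ℝ
    exact hlog.comp_contDiffWithinAt p ((hquot.mono Set.inter_subset_left) p hp)
  · rintro p ⟨-, hp⟩
    have hc0 : c ≠ 0 := by
      rintro rfl
      exact h0 (by simpa using hc.symm)
    refine ⟨mul_ne_zero hc0 (Complex.exp_ne_zero _), ?_⟩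
    rw [mul_pow, ← Complex.exp_nat_mul, hc, Nat.cast_two, mul_div_cancel₀ _ two_ne_zero,
      Complex.exp_log (Complex.slitPlane_ne_zero hp), mul_div_cancel₀ _ h0]

theorem exists_contDiffOn_sqrt_pair (hD : IsOpen D) (hA : ContDiffOn ℝ ∞ A D)
    (hC : ContDiffOn ℝ ∞ C D) (hAB : ∀ p ∈ D, A p * B p = C p ^ 2) (hw : w ∈ D) (h0 : A w ≠ 0) :
    ∃ D' ⊆ D, IsOpen D' ∧ w ∈ D' ∧ ∃ χ₁ χ₂ : E → ℂ, ContDiffOn ℝ ∞ χ₁ D' ∧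
      ContDiffOn ℝ ∞ χ₂ D' ∧ ∀ p ∈ D', χ₁ p ^ 2 = A p ∧ χ₂ p ^ 2 = B p ∧ χ₁ p * χ₂ p = C p := by
  obtain ⟨D', hsub, hopen, hwD', χ, hχ, hsqrt⟩ := exists_contDiffOn_sqrt hD hA hw h0
  have hdiv : ContDiffOn ℝ ∞ (fun p => C p / χ p) D' := by
    simp only [div_eq_mul_inv]
    exact (hC.mono hsub).mul (hχ.inv fun p hp => (hsqrt p hp).1)
  refine ⟨D', hsub, hopen, hwD', χ, fun p => C p / χ p, hχ, hdiv, fun p hp => ?_⟩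
  obtain ⟨hne, hsq⟩ := hsqrt p hp
  refine ⟨hsq, ?_, mul_div_cancel₀ _ hne⟩
  rw [div_pow, ← hAB p (hsub hp), ← hsq, mul_div_cancel_left₀ _ (pow_ne_zero 2 hne)]

end SquareRoots

section Existence

variable {F : ℂ → SLTilde} {D : Set ℂ} {w : ℂ}

theorem ConformalOn.nullCoord_ne_zero (h : ConformalOn F D) (hw : w ∈ D) :
    nullCoord F (-1) w ≠ 0 ∨ nullCoord F 1 w ≠ 0 := by
  by_contra! hzero
  obtain ⟨hminus, hplus⟩ := hzero
  have hZ2 : zCoord F w 2 = 0 := by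
    simpa [hminus] using (h.nullCoord_mul_nullCoord hw).symm
  simp only [nullCoord] at hminus hplus
  have hZ1 : zCoord F w 1 = 0 := by linear_combination (hplus - hminus) / 2
  have hZ0 : zCoord F w 0 = 0 := by
    linear_combination Complex.I / 2 * (hplus + hminus) + zCoord F w 0 * Complex.I_sq
  have hE := h.ofReal_firstForm hw
  rw [dotProduct, Fin.sum_univ_three, hZ0, hZ1, hZ2] at hE
  exact (h.conformal w hw).1.ne' (by simpa using hE)

theorem ConformalOn.exists_isGeneratingSpinor (h : ConformalOn F D) (hw : w ∈ D) :
    ∃ D' ⊆ D, IsOpen D' ∧ w ∈ D' ∧ ∃ ψ₁ ψ₂ : ℂ → ℂ, IsGeneratingSpinor F D' ψ₁ ψ₂ := by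
  have hminus := h.smoothOn.contDiffOn_nullCoord h.isOpen (-1)
  have hplus := h.smoothOn.contDiffOn_nullCoord h.isOpen 1
  have hZ2 := h.smoothOn.contDiffOn_zCoord h.isOpen 2
  have hmul p (hp : p ∈ D) := h.nullCoord_mul_nullCoord hp
  obtain ⟨D', hsub, hopen, hwD', χ₁, χ₂, hχ₁, hχ₂, hsqrt⟩ : ∃ D' ⊆ D, IsOpen D' ∧ w ∈ D' ∧
      ∃ χ₁ χ₂ : ℂ → ℂ, ContDiffOn ℝ ∞ χ₁ D' ∧ ContDiffOn ℝ ∞ χ₂ D' ∧ ∀ p ∈ D',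
        χ₁ p ^ 2 = nullCoord F (-1) p ∧ χ₂ p ^ 2 = nullCoord F 1 p ∧
          χ₁ p * χ₂ p = zCoord F p 2 := by
    rcases h.nullCoord_ne_zero hw with hne | hne
    · exact exists_contDiffOn_sqrt_pair h.isOpen hminus hZ2 hmul hw hne
    · obtain ⟨D', hsub, hopen, hwD', χ₂, χ₁, hχ₂, hχ₁, hsqrt⟩ := exists_contDiffOn_sqrt_pair
        h.isOpen hplus hZ2 (fun p hp => (mul_comm _ _).trans (hmul p hp)) hw hne
      exact ⟨D', hsub, hopen, hwD', χ₁, χ₂, hχ₁, hχ₂, fun p hp =>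
        ⟨(hsqrt p hp).2.1, (hsqrt p hp).1, (mul_comm _ _).trans (hsqrt p hp).2.2⟩⟩
  refine ⟨D', hsub, hopen, hwD', χ₁, fun p => conj (χ₂ p), isGeneratingSpinor_iff.2
    ⟨hχ₁, Complex.conjCLE.contDiff.comp_contDiffOn hχ₂, fun p hp => ?_⟩⟩
  simpa only [Complex.conj_conj] using hsqrt p hp

end Existence

/-! ### Change of the conformal parameter -/

section Holomorphic

variable {E : Type*} [NormedAddCommGroup E] [NormedSpace ℝ E]

theorem apply_eq_re_smul_add_im_smul (L : ℂ →L[ℝ] E) (c : ℂ) :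
    L c = c.re • L 1 + c.im • L Complex.I := by
  rw [← map_smul, ← map_smul, ← map_add]
  congr 1
  apply Complex.ext <;> simp

variable {φ : ℂ → ℂ} {w : ℂ}

theorem fderiv_real_apply (hφ : DifferentiableAt ℂ φ w) (v : ℂ) :
    fderiv ℝ φ w v = deriv φ w * v := by
  simp [hφ.hasDerivAt.complexToReal_fderiv.fderiv]

theorem fderiv_comp_apply {g : ℂ → E} (hg : DifferentiableAt ℝ g (φ w))
    (hφ : DifferentiableAt ℂ φ w) (v : ℂ) :
    fderiv ℝ (fun p => g (φ p)) w v = fderiv ℝ g (φ w) (deriv φ w * v) := by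
  rw [fderiv_fun_comp w hg (hφ.restrictScalars ℝ), ContinuousLinearMap.comp_apply,
    fderiv_real_apply hφ]

theorem dzbar_eq_zero (hφ : DifferentiableAt ℂ φ w) : dzbar φ w = 0 := by
  rw [dzbar, fderiv_real_apply hφ, fderiv_real_apply hφ]
  linear_combination deriv φ w / 2 * Complex.I_sq

theorem dzbar_comp {g : ℂ → ℂ} (hg : DifferentiableAt ℝ g (φ w)) (hφ : DifferentiableAt ℂ φ w) :
    dzbar (fun p => g (φ p)) w = conj (deriv φ w) * dzbar g (φ w) := by
  have hconj : conj (deriv φ w) = (deriv φ w).re - (deriv φ w).im * Complex.I := by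
    apply Complex.ext <;> simp
  rw [dzbar, fderiv_comp_apply hg hφ, fderiv_comp_apply hg hφ,
    apply_eq_re_smul_add_im_smul _ (deriv φ w * 1),
    apply_eq_re_smul_add_im_smul _ (deriv φ w * Complex.I), dzbar, hconj]
  simp only [mul_one, Complex.real_smul, Complex.mul_I_re, Complex.mul_I_im, Complex.ofReal_neg]
  linear_combination (deriv φ w).im * fderiv ℝ g (φ w) Complex.I / 2 * Complex.I_sq

theorem dzbar_mul {g h : ℂ → ℂ} (hg : DifferentiableAt ℝ g w) (hh : DifferentiableAt ℝ h w) :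
    dzbar (fun p => g p * h p) w = g w * dzbar h w + dzbar g w * h w := by
  simp only [dzbar, fderiv_fun_mul hg hh, add_apply, smul_apply, smul_eq_mul]
  ring

end Holomorphic

theorem leftDeriv_eq_smul_add (F : ℂ → SLTilde) (w v : ℂ) :
    leftDeriv F w v = v.re • leftDeriv F w 1 + v.im • leftDeriv F w Complex.I := by
  have hmat : matDeriv (fun p => (F p).mat) w v = v.re • matDeriv (fun p => (F p).mat) w 1 +
      v.im • matDeriv (fun p => (F p).mat) w Complex.I := by
    ext i j
    exact apply_eq_re_smul_add_im_smul _ v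
  simp only [leftDeriv_eq_coord_leftMat, leftMat, hmat, Matrix.mul_add, Matrix.mul_smul]
  ext k
  fin_cases k <;> simp [coord] <;> ring

/-- `φ` is a holomorphic map of parameter domains which pulls the conformal immersion `G` of `D'`
back to the conformal immersion `F` of `D`. -/
structure ParamChange (F : ℂ → SLTilde) (D : Set ℂ) (G : ℂ → SLTilde) (D' : Set ℂ)
    (φ : ℂ → ℂ) : Prop where
  left : ConformalOn F D
  right : ConformalOn G D'
  differentiableOn : DifferentiableOn ℂ φ D
  mapsTo : Set.MapsTo φ D D'
  eq : ∀ w ∈ D, F w = G (φ w)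

/-- The derivative of the function `r` in the direction of the tangential part of the left invariant
field `e₃`, in a conformal parameter. -/
noncomputable def tangentialDeriv (F : ℂ → SLTilde) (r : ℂ → ℝ) (w : ℂ) : ℝ :=
  (fderiv ℝ r w 1 * leftDeriv F w 1 2 + fderiv ℝ r w Complex.I * leftDeriv F w Complex.I 2) /
    firstForm F w 1 1

namespace ParamChange

variable {F G : ℂ → SLTilde} {D D' : Set ℂ} {φ : ℂ → ℂ} {w : ℂ}

theorem differentiableAt (h : ParamChange F D G D' φ) (hw : w ∈ D) : DifferentiableAt ℂ φ w :=
  h.differentiableOn.differentiableAt (h.left.isOpen.mem_nhds hw)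

theorem leftDeriv_eq (h : ParamChange F D G D' φ) (hw : w ∈ D) (v : ℂ) :
    leftDeriv F w v = leftDeriv G (φ w) (deriv φ w * v) := by
  have hmat (i j) : fderiv ℝ (fun p => (F p).mat i j) w v =
      fderiv ℝ (fun p => (G p).mat i j) (φ w) (deriv φ w * v) := by
    have hG : DifferentiableAt ℝ (fun p => (G p).mat i j) (φ w) :=
      ((h.right.smoothOn.contDiffOn_mat i j).contDiffAt
        (h.right.isOpen.mem_nhds (h.mapsTo hw))).differentiableAt (by simp)
    rw [← fderiv_comp_apply hG (h.differentiableAt hw), Filter.EventuallyEq.fderiv_eq]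
    filter_upwards [h.left.isOpen.mem_nhds hw] with p hp
    rw [h.eq p hp]
  simp only [leftDeriv, hmat, h.eq w hw]

theorem zCoord_eq (h : ParamChange F D G D' φ) (hw : w ∈ D) :
    zCoord F w = deriv φ w • zCoord G (φ w) := by
  ext k
  rw [Pi.smul_apply, smul_eq_mul]
  conv_rhs => rw [← Complex.re_add_im (deriv φ w)]
  simp only [zCoord, h.leftDeriv_eq hw, leftDeriv_eq_smul_add G _ (deriv φ w * _), Pi.add_apply,
    Pi.smul_apply, smul_eq_mul, Complex.mul_I_re, Complex.mul_I_im]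
  rw [mul_one]
  push_cast
  linear_combination (deriv φ w).im * (leftDeriv G (φ w) Complex.I k) / 2 * Complex.I_sq

theorem firstForm_eq (h : ParamChange F D G D' φ) (hw : w ∈ D) :
    firstForm F w 1 1 = Complex.normSq (deriv φ w) * firstForm G (φ w) 1 1 := by
  apply Complex.ofReal_injective
  push_cast
  simp only [h.left.ofReal_firstForm hw, h.right.ofReal_firstForm (h.mapsTo hw), h.zCoord_eq hw,
    ← Complex.mul_conj, dotProduct, Fin.sum_univ_three, Pi.smul_apply, smul_eq_mul, map_mul]
  ring

theorem areaVector_eq (h : ParamChange F D G D' φ) (hw : w ∈ D) :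
    areaVector F w = Complex.normSq (deriv φ w) • areaVector G (φ w) := by
  ext k
  apply Complex.ofReal_injective
  simp only [Pi.smul_apply, smul_eq_mul, Complex.ofReal_mul, ofReal_areaVector, h.zCoord_eq hw,
    ← Complex.mul_conj, map_mul]
  fin_cases k <;> simp [cross_apply] <;> ring

theorem normSq_deriv_pos (h : ParamChange F D G D' φ) (hw : w ∈ D) :
    0 < Complex.normSq (deriv φ w) := by
  have hpos := (h.left.conformal w hw).1
  rw [h.firstForm_eq hw] at hpos
  exact pos_of_mul_pos_left hpos (h.right.conformal _ (h.mapsTo hw)).1.le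

theorem unitNormal_eq (h : ParamChange F D G D' φ) (hw : w ∈ D) :
    unitNormal F w = unitNormal G (φ w) := by
  rw [SLTilde.unitNormal_eq, SLTilde.unitNormal_eq, h.left.sqrt_gramDet hw,
    h.right.sqrt_gramDet (h.mapsTo hw), h.firstForm_eq hw, h.areaVector_eq hw, smul_smul, mul_inv,
    mul_right_comm, inv_mul_cancel₀ (h.normSq_deriv_pos hw).ne', one_mul]

theorem dzbar_zCoord (h : ParamChange F D G D' φ) (hw : w ∈ D) (k : Fin 3) :
    dzbar (fun p => zCoord F p k) w =
      Complex.normSq (deriv φ w) * dzbar (fun p => zCoord G p k) (φ w) := by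
  have hφ := h.differentiableAt hw
  have hφ' : DifferentiableAt ℂ (deriv φ) w :=
    (h.differentiableOn.deriv h.left.isOpen).differentiableAt (h.left.isOpen.mem_nhds hw)
  have hG : DifferentiableAt ℝ (fun p => zCoord G p k) (φ w) :=
    ((h.right.smoothOn.contDiffOn_zCoord h.right.isOpen k).contDiffAt
      (h.right.isOpen.mem_nhds (h.mapsTo hw))).differentiableAt (by simp)
  have hGφ : DifferentiableAt ℝ (fun p => zCoord G (φ p) k) w :=
    hG.comp w (hφ.restrictScalars ℝ)
  have hpull : (fun p => zCoord F p k) =ᶠ[nhds w] fun p => deriv φ p * zCoord G (φ p) k := by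
    filter_upwards [h.left.isOpen.mem_nhds hw] with p hp using congrFun (h.zCoord_eq hp) k
  rw [dzbar, hpull.fderiv_eq, ← dzbar, dzbar_mul (hφ'.restrictScalars ℝ) hGφ,
    dzbar_eq_zero hφ', dzbar_comp hG hφ, ← Complex.mul_conj]
  ring

theorem meanCurvatureAt_eq (h : ParamChange F D G D' φ) (hw : w ∈ D) :
    meanCurvatureAt F w = meanCurvatureAt G (φ w) := by
  have hw' := h.mapsTo hw
  obtain ⟨k, hk⟩ : ∃ k, areaVector G (φ w) k ≠ 0 := by
    refine Function.ne_iff.1 fun hzero => (h.right.gramDet_pos hw').ne' ?_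
    rw [← areaVector_dotProduct_self, hzero]
    exact zero_dotProduct _
  have hrot : (![-(deriv φ w • zCoord G (φ w)) 1, (deriv φ w • zCoord G (φ w)) 0, 0] : Fin 3 → ℂ) k
      = deriv φ w * (![-zCoord G (φ w) 1, zCoord G (φ w) 0, 0] : Fin 3 → ℂ) k := by
    fin_cases k <;> simp
  have hstructure := h.dzbar_zCoord hw k
  rw [h.left.dzbar_zCoord hw, h.right.dzbar_zCoord hw', h.areaVector_eq hw, h.zCoord_eq hw, hrot]
    at hstructure
  have hk' : ((Complex.normSq (deriv φ w) * areaVector G (φ w) k : ℝ) : ℂ) ≠ 0 :=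
    Complex.ofReal_ne_zero.2 (mul_ne_zero (h.normSq_deriv_pos hw).ne' hk)
  apply Complex.ofReal_injective
  refine mul_right_cancel₀ hk' ?_
  simp only [Pi.smul_apply, smul_eq_mul, map_mul, Complex.ofReal_mul, ← Complex.mul_conj]
    at hstructure ⊢
  linear_combination 2 * hstructure

theorem tangentSectionalAt_eq (h : ParamChange F D G D' φ) (hw : w ∈ D) :
    tangentSectionalAt F w = tangentSectionalAt G (φ w) := by
  rw [SLTilde.tangentSectionalAt_eq (h.left.gramDet_pos hw),
    SLTilde.tangentSectionalAt_eq (h.right.gramDet_pos (h.mapsTo hw)), h.unitNormal_eq hw]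

theorem tangentialDeriv_eq (h : ParamChange F D G D' φ) (hw : w ∈ D) {r s : ℂ → ℝ}
    (hs : DifferentiableAt ℝ s (φ w)) (hr : Set.EqOn r (s ∘ φ) D) :
    tangentialDeriv F r w = tangentialDeriv G s (φ w) := by
  have hpull : r =ᶠ[nhds w] fun p => s (φ p) := hr.eventuallyEq_of_mem (h.left.isOpen.mem_nhds hw)
  have hnormSq := h.normSq_deriv_pos hw
  have hfirst := (h.right.conformal _ (h.mapsTo hw)).1
  rw [tangentialDeriv, tangentialDeriv, h.firstForm_eq hw,
    div_eq_div_iff (by positivity) (by positivity), Complex.normSq_apply, hpull.fderiv_eq]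
  simp only [fderiv_comp_apply hs (h.differentiableAt hw), h.leftDeriv_eq hw,
    leftDeriv_eq_smul_add G _ (deriv φ w * _), apply_eq_re_smul_add_im_smul _ (deriv φ w * _),
    Pi.add_apply, Pi.smul_apply, smul_eq_mul, Complex.mul_I_re, Complex.mul_I_im]
  ring_nf

end ParamChange

/-! ### Local parameters and the area measure -/

section LocalParams

variable {M : Type*} [TopologicalSpace M] [ChartedSpace ℂ M]

theorem contDiffGroupoid_complex_le_real :
    contDiffGroupoid ω 𝓘(ℂ) ≤ contDiffGroupoid ∞ 𝓘(ℝ, ℂ) := by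
  intro e he
  change e ∈ contDiffGroupoid ω 𝓘(ℂ) at he
  change e ∈ contDiffGroupoid ∞ 𝓘(ℝ, ℂ)
  rw [contDiffGroupoid, mem_groupoid_of_pregroupoid] at he ⊢
  exact ⟨(he.1.restrict_scalars ℝ).of_le le_top, (he.2.restrict_scalars ℝ).of_le le_top⟩

theorem isManifold_real [IsManifold 𝓘(ℂ) ω M] : IsManifold 𝓘(ℝ, ℂ) ∞ M :=
  have : HasGroupoid M (contDiffGroupoid ω 𝓘(ℂ)) := inferInstance
  have : HasGroupoid M (contDiffGroupoid ∞ 𝓘(ℝ, ℂ)) :=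
    hasGroupoid_of_le this contDiffGroupoid_complex_le_real
  IsManifold.mk' _ _ _

theorem localParams_subset_maximalAtlas_real :
    localParams M ⊆ IsManifold.maximalAtlas 𝓘(ℝ, ℂ) ∞ M :=
  StructureGroupoid.maximalAtlas_mono contDiffGroupoid_complex_le_real

variable {f : M → SLTilde} {e e' : OpenPartialHomeomorph M ℂ}

theorem differentiableOn_transition (he : e ∈ localParams M) (he' : e' ∈ localParams M) :
    DifferentiableOn ℂ (e.symm ≫ₕ e') (e.symm ≫ₕ e').source :=
  (contMDiffOn_of_mem_contDiffGroupoid (StructureGroupoid.compatible_of_mem_maximalAtlas he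
    he')).contDiffOn.differentiableOn (by simp)

variable [IsManifold 𝓘(ℂ) ω M]

theorem chartAt_mem_localParams (p : M) : chartAt ℂ p ∈ localParams M :=
  IsManifold.chart_mem_maximalAtlas p

theorem contMDiffOn_symm_of_mem_localParams (he : e ∈ localParams M) :
    ContMDiffOn 𝓘(ℝ, ℂ) 𝓘(ℝ, ℂ) ∞ e.symm e.target :=
  have := isManifold_real (M := M)
  contMDiffOn_symm_of_mem_maximalAtlas (localParams_subset_maximalAtlas_real he)

theorem contDiffOn_comp_symm {E : Type*} [NormedAddCommGroup E] [NormedSpace ℝ E] {r : M → E}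
    (hr : ContMDiff 𝓘(ℝ, ℂ) 𝓘(ℝ, E) ∞ r) (he : e ∈ localParams M) :
    ContDiffOn ℝ ∞ (r ∘ e.symm) e.target :=
  (hr.comp_contMDiffOn (contMDiffOn_symm_of_mem_localParams he)).contDiffOn

theorem conformalOn_inParam (hf : IsConformalImmersion f) (he : e ∈ localParams M) :
    ConformalOn (inParam f e) e.target where
  isOpen := e.open_target
  smoothOn := contDiffOn_comp_symm (contMDiff_subtype_val.comp hf.1) he
  conformal := hf.2 e he

theorem aemeasurable_areaDensity (hf : IsConformalImmersion f) (he : e ∈ localParams M) :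
    AEMeasurable (fun w => ENNReal.ofReal (Real.sqrt (gramDet (inParam f e) w)))
      (MeasureTheory.volume.restrict e.target) := by
  have hF := conformalOn_inParam hf he
  exact (ENNReal.continuous_ofReal.comp_continuousOn
    ((hF.smoothOn.continuousOn_firstForm hF.isOpen 1 1).congr fun _ hw =>
      hF.sqrt_gramDet hw)).aemeasurable e.open_target.measurableSet

theorem toReal_areaDensity (hf : IsConformalImmersion f) (he : e ∈ localParams M) {w : ℂ}
    (hw : w ∈ e.target) : (ENNReal.ofReal (Real.sqrt (gramDet (inParam f e) w))).toReal =
      firstForm (inParam f e) w 1 1 := by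
  rw [ENNReal.toReal_ofReal (Real.sqrt_nonneg _), (conformalOn_inParam hf he).sqrt_gramDet hw]

theorem paramChange_inParam (hf : IsConformalImmersion f) (he : e ∈ localParams M)
    (he' : e' ∈ localParams M) :
    ParamChange (inParam f e) (e.symm ≫ₕ e').source (inParam f e') e'.target (e.symm ≫ₕ e') where
  left := (conformalOn_inParam hf he).mono (e.symm ≫ₕ e').open_source fun _ hw => hw.1
  right := conformalOn_inParam hf he'
  differentiableOn := differentiableOn_transition he he'
  mapsTo _ hw := e'.map_source hw.2
  eq _ hw := congrArg f (e'.left_inv hw.2).symm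

/-- The expressions `q e` in the local parameters `e` agree on overlaps, so that they define a
function on the surface. -/
def IsParamInvariant {E : Type*} (q : OpenPartialHomeomorph M ℂ → ℂ → E) : Prop :=
  ∀ e ∈ localParams M, ∀ e' ∈ localParams M,
    Set.EqOn (q e) (q e' ∘ (e.symm ≫ₕ e')) (e.symm ≫ₕ e').source

/-- The function on the surface with the expressions `q e` in the local parameters `e`. It is read
off in the preferred chart, which is immaterial if `q` is invariant. -/
noncomputable def ofParam {E : Type*} (q : OpenPartialHomeomorph M ℂ → ℂ → E) (p : M) : E :=
  q (chartAt ℂ p) (chartAt ℂ p p)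

namespace IsParamInvariant

variable {E : Type*} {q : OpenPartialHomeomorph M ℂ → ℂ → E}

theorem ofParam_eq (hq : IsParamInvariant q) (he : e ∈ localParams M) {p : M}
    (hp : p ∈ e.source) : ofParam q p = q e (e p) := by
  have hp' := mem_chart_source ℂ p
  have hoverlap : chartAt ℂ p p ∈ ((chartAt ℂ p).symm ≫ₕ e).source :=
    ⟨mem_chart_target ℂ p, by simpa [(chartAt ℂ p).left_inv hp'] using hp⟩
  refine (hq _ (chartAt_mem_localParams p) e he hoverlap).trans ?_
  simp [(chartAt ℂ p).left_inv hp']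

theorem ofParam_symm (hq : IsParamInvariant q) (he : e ∈ localParams M) {w : ℂ}
    (hw : w ∈ e.target) : ofParam q (e.symm w) = q e w := by
  rw [hq.ofParam_eq he (e.map_target hw), e.right_inv hw]

theorem continuous_ofParam [TopologicalSpace E] (hq : IsParamInvariant q)
    (hcont : ∀ e ∈ localParams M, ContinuousOn (q e) e.target) : Continuous (ofParam q) := by
  refine continuous_iff_continuousAt.2 fun p => ?_
  have he := chartAt_mem_localParams (M := M) p
  refine ContinuousOn.continuousAt ?_ (chart_source_mem_nhds ℂ p)
  exact ((hcont _ he).comp (chartAt ℂ p).continuousOn (chartAt ℂ p).mapsTo).congr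
    fun p' hp' => hq.ofParam_eq he hp'

end IsParamInvariant

theorem isParamInvariant_meanCurvatureAt (hf : IsConformalImmersion f) :
    IsParamInvariant (M := M) fun e => meanCurvatureAt (inParam f e) :=
  fun _ he _ he' _ hw => (paramChange_inParam hf he he').meanCurvatureAt_eq hw

theorem isParamInvariant_tangentSectionalAt (hf : IsConformalImmersion f) :
    IsParamInvariant (M := M) fun e => tangentSectionalAt (inParam f e) :=
  fun _ he _ he' _ hw => (paramChange_inParam hf he he').tangentSectionalAt_eq hw

theorem isParamInvariant_unitNormal (hf : IsConformalImmersion f) :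
    IsParamInvariant (M := M) fun e => unitNormal (inParam f e) :=
  fun _ he _ he' _ hw => (paramChange_inParam hf he he').unitNormal_eq hw

end LocalParams

section AreaMeasure

open MeasureTheory

theorem restrict_iSup {α : Type*} [MeasurableSpace α] {ι : Sort*} (μ : ι → Measure α) {s : Set α}
    (hs : MeasurableSet s) : (⨆ i, μ i).restrict s = ⨆ i, (μ i).restrict s := by
  refine le_antisymm ?_ (iSup_le fun i => Measure.restrict_mono le_rfl (le_iSup μ i))
  have hle : ⨆ i, μ i ≤ (⨆ i, (μ i).restrict s) + (⨆ i, μ i).restrict sᶜ := iSup_le fun i =>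
    calc μ i = (μ i).restrict s + (μ i).restrict sᶜ := (Measure.restrict_add_restrict_compl hs).symm
      _ ≤ _ := add_le_add (le_iSup (fun i => (μ i).restrict s) i)
        (Measure.restrict_mono le_rfl (le_iSup μ i))
  refine (Measure.restrict_mono le_rfl hle).trans ?_
  rw [Measure.restrict_add, Measure.restrict_restrict hs, Set.inter_compl_self,
    Measure.restrict_empty, add_zero]
  exact Measure.restrict_le_self

theorem det_fderiv_real {φ : ℂ → ℂ} {w : ℂ} (hφ : DifferentiableAt ℂ φ w) :
    (fderiv ℝ φ w).det = Complex.normSq (deriv φ w) := by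
  rw [(hφ.hasDerivAt.hasFDerivAt.restrictScalars ℝ).fderiv]
  simp [ContinuousLinearMap.det, LinearMap.det_restrictScalars, Algebra.norm_complex_eq]

variable {M : Type*} [TopologicalSpace M]

theorem image_transition {X : Type*} [TopologicalSpace X] (e e' : OpenPartialHomeomorph M X)
    (s : Set M) :
    (e.symm ≫ₕ e') '' (e.target ∩ e.symm ⁻¹' (s ∩ e'.source)) =
      e'.target ∩ e'.symm ⁻¹' (s ∩ e.source) := by
  ext w
  constructor
  · rintro ⟨p, ⟨hp, hps, hp'⟩, rfl⟩
    refine ⟨e'.map_source hp', ?_⟩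
    simpa [e'.left_inv hp'] using ⟨hps, e.map_target hp⟩
  · rintro ⟨hw, hws, hw'⟩
    refine ⟨e (e'.symm w), ⟨e.map_source hw', ?_⟩, ?_⟩
    · simpa [e.left_inv hw'] using ⟨hws, e'.map_target hw⟩
    · simp [e.left_inv hw', e'.right_inv hw]

variable [MeasurableSpace M] [BorelSpace M]

theorem measurableSet_target_inter_preimage {X : Type*} [TopologicalSpace X] [MeasurableSpace X]
    [BorelSpace X] (e : OpenPartialHomeomorph M X) {s : Set M} (hs : MeasurableSet s) :
    MeasurableSet (e.target ∩ e.symm ⁻¹' s) := by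
  have hcont := continuousOn_iff_continuous_domRestrict.1 e.continuousOn_symm
  rw [← Subtype.image_preimage_val]
  exact e.open_target.measurableSet.subtype_image (hcont.measurable hs)

/-- The area measure of a surface in the domain of the local parameter `e`. -/
noncomputable def localArea (f : M → SLTilde) (e : OpenPartialHomeomorph M ℂ) : Measure M :=
  ((volume.restrict e.target).withDensity
    fun w => ENNReal.ofReal (Real.sqrt (gramDet (inParam f e) w))).map e.symm

theorem aemeasurable_symm_areaDensity (f : M → SLTilde) (e : OpenPartialHomeomorph M ℂ) :
    AEMeasurable e.symm ((volume.restrict e.target).withDensity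
      fun w => ENNReal.ofReal (Real.sqrt (gramDet (inParam f e) w))) :=
  (e.continuousOn_symm.aemeasurable e.open_target.measurableSet).mono_ac
    (withDensity_absolutelyContinuous _ _)

theorem localArea_apply (f : M → SLTilde) (e : OpenPartialHomeomorph M ℂ) {s : Set M}
    (hs : MeasurableSet s) : localArea f e s =
      ∫⁻ w in e.target ∩ e.symm ⁻¹' s, ENNReal.ofReal (Real.sqrt (gramDet (inParam f e) w)) := by
  rw [localArea, Measure.map_apply_of_aemeasurable (aemeasurable_symm_areaDensity f e) hs,
    withDensity_apply', Measure.restrict_restrict' e.open_target.measurableSet, Set.inter_comm]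

theorem restrict_localArea_source (f : M → SLTilde) (e : OpenPartialHomeomorph M ℂ) :
    (localArea f e).restrict e.source = localArea f e := by
  ext s hs
  have hdomain : e.target ∩ e.symm ⁻¹' (s ∩ e.source) = e.target ∩ e.symm ⁻¹' s := by
    rw [Set.preimage_inter, ← Set.inter_assoc, Set.inter_eq_left]
    exact fun w hw => e.map_target hw.1
  rw [Measure.restrict_apply hs, localArea_apply f e hs,
    localArea_apply f e (hs.inter e.open_source.measurableSet), hdomain]

variable [ChartedSpace ℂ M] [IsManifold 𝓘(ℂ) ω M] {f : M → SLTilde}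
  {e e' : OpenPartialHomeomorph M ℂ}

theorem restrict_localArea_comm (hf : IsConformalImmersion f) (he : e ∈ localParams M)
    (he' : e' ∈ localParams M) :
    (localArea f e).restrict e'.source = (localArea f e').restrict e.source := by
  ext s hs
  have hchange := paramChange_inParam hf he he'
  have hs' := hs.inter e'.open_source.measurableSet
  have hmeas := measurableSet_target_inter_preimage e hs'
  have hsub : e.target ∩ e.symm ⁻¹' (s ∩ e'.source) ⊆ (e.symm ≫ₕ e').source :=
    fun w hw => ⟨hw.1, hw.2.2⟩
  rw [Measure.restrict_apply hs, Measure.restrict_apply hs, localArea_apply f e hs',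
    localArea_apply f e' (hs.inter e.open_source.measurableSet), ← image_transition e e' s,
    lintegral_image_eq_lintegral_abs_det_fderiv_mul volume hmeas
      (fun w hw => ((hchange.differentiableAt (hsub hw)).restrictScalars
        ℝ).hasFDerivAt.hasFDerivWithinAt) ((e.symm ≫ₕ e').injOn.mono hsub)]
  refine setLIntegral_congr_fun hmeas fun w hw => ?_
  have hw' := hsub hw
  rw [det_fderiv_real (hchange.differentiableAt hw'), ← ENNReal.ofReal_mul (abs_nonneg _),
    hchange.left.sqrt_gramDet hw', hchange.right.sqrt_gramDet (hchange.mapsTo hw'),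
    hchange.firstForm_eq hw', abs_of_nonneg (Complex.normSq_nonneg _)]

theorem restrict_areaMeasure_source (hf : IsConformalImmersion f) (he : e ∈ localParams M) :
    (areaMeasure f).restrict e.source = localArea f e := by
  have hsup : areaMeasure f = ⨆ e' ∈ localParams M, localArea f e' := rfl
  simp only [hsup, restrict_iSup _ e.open_source.measurableSet]
  refine le_antisymm (iSup₂_le fun e' he' => ?_) (le_iSup₂_of_le e he ?_)
  · rw [restrict_localArea_comm hf he' he]
    exact Measure.restrict_le_self
  · rw [restrict_localArea_source]

theorem isLocallyFiniteMeasure_areaMeasure (hf : IsConformalImmersion f) :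
    IsLocallyFiniteMeasure (areaMeasure f) := by
  refine ⟨fun p => ?_⟩
  set e := chartAt ℂ p
  have he : e ∈ localParams M := chartAt_mem_localParams p
  have hF := conformalOn_inParam hf he
  obtain ⟨ε, hε, hball⟩ := Metric.nhds_basis_closedBall.mem_iff.1
    (e.open_target.mem_nhds (mem_chart_target ℂ p))
  have hopen : IsOpen (e.source ∩ e ⁻¹' Metric.ball (e p) ε) :=
    e.isOpen_inter_preimage Metric.isOpen_ball
  refine ⟨_, hopen.mem_nhds ⟨mem_chart_source ℂ p, Metric.mem_ball_self hε⟩, ?_⟩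
  have hsub : e.target ∩ e.symm ⁻¹' (e.source ∩ e ⁻¹' Metric.ball (e p) ε) ⊆
      Metric.closedBall (e p) ε := fun w ⟨hw, _, hw'⟩ => by
    rw [Set.mem_preimage, e.right_inv hw] at hw'
    exact Metric.ball_subset_closedBall hw'
  have hint : IntegrableOn (fun w => Real.sqrt (gramDet (inParam f e) w))
      (Metric.closedBall (e p) ε) :=
    (((hF.smoothOn.continuousOn_firstForm hF.isOpen 1 1).congr fun _ hw =>
      hF.sqrt_gramDet hw).mono hball).integrableOn_compact (isCompact_closedBall _ _)
  rw [← Measure.restrict_eq_self (areaMeasure f) Set.inter_subset_left,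
    restrict_areaMeasure_source hf he, localArea_apply f e hopen.measurableSet]
  exact (lintegral_mono_set hsub).trans_lt hint.lintegral_lt_top

variable {E : Type*} [NormedAddCommGroup E] {g : M → E}

theorem integrable_areaMeasure_of_hasCompactSupport (hf : IsConformalImmersion f)
    (hg : Continuous g) (hs : HasCompactSupport g) : Integrable g (areaMeasure f) :=
  have := isLocallyFiniteMeasure_areaMeasure hf
  hg.integrable_of_hasCompactSupport hs

theorem integral_areaMeasure_of_support_subset [NormedSpace ℝ E] (hf : IsConformalImmersion f)
    (he : e ∈ localParams M) (hg : AEStronglyMeasurable g (areaMeasure f))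
    (hs : Function.support g ⊆ e.source) : ∫ p, g p ∂(areaMeasure f) =
      ∫ w in e.target, firstForm (inParam f e) w 1 1 • g (e.symm w) := by
  have hg' := hg.restrict (s := e.source)
  rw [restrict_areaMeasure_source hf he, localArea] at hg'
  rw [← setIntegral_eq_integral_of_forall_compl_eq_zero (s := e.source)
      fun p hp => Function.notMem_support.1 fun hp' => hp (hs hp'),
    restrict_areaMeasure_source hf he, localArea,
    integral_map (aemeasurable_symm_areaDensity f e) hg',
    integral_withDensity_eq_integral_toReal_smul₀ (aemeasurable_areaDensity hf he)
      (Filter.Eventually.of_forall fun _ => ENNReal.ofReal_lt_top)]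
  exact setIntegral_congr_fun e.open_target.measurableSet fun w hw => by
    rw [toReal_areaDensity hf he hw]

theorem integral_areaMeasure_eq_sum [NormedSpace ℝ E] [CompactSpace M]
    (hf : IsConformalImmersion f) {ι : Type*} [Fintype ι] {c : ι → OpenPartialHomeomorph M ℂ}
    (hc : ∀ i, c i ∈ localParams M) (ρ : PartitionOfUnity ι M Set.univ)
    (hρ : ρ.IsSubordinate fun i => (c i).source) (hg : Continuous g) :
    ∫ p, g p ∂(areaMeasure f) = ∑ i, ∫ w in (c i).target,
      firstForm (inParam f (c i)) w 1 1 • (ρ i ((c i).symm w) • g ((c i).symm w)) := by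
  have hint (i) : Integrable (fun p => ρ i p • g p) (areaMeasure f) :=
    integrable_areaMeasure_of_hasCompactSupport hf ((ρ i).continuous.smul hg)
      (HasCompactSupport.of_compactSpace _)
  have hsum : g = fun p => ∑ i, ρ i p • g p := by
    ext p
    rw [← Finset.sum_smul, ← finsum_eq_sum_of_fintype, ρ.sum_eq_one (Set.mem_univ p), one_smul]
  conv_lhs => rw [hsum]
  rw [integral_finsetSum _ fun i _ => hint i]
  refine Finset.sum_congr rfl fun i _ => integral_areaMeasure_of_support_subset hf (hc i)
    (hint i).aestronglyMeasurable ?_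
  exact (Function.support_smul_subset_left _ _).trans ((subset_tsupport _).trans (hρ i))

end AreaMeasure

open MeasureTheory

/-! ### The divergence theorem for the Killing field `e₃` -/

section Indicator

theorem indicator_eqOn_compl {X Y : Type*} [Zero Y] {D K : Set X} {g : X → Y}
    (h0 : ∀ w ∈ D, w ∉ K → g w = 0) : Set.EqOn (D.indicator g) 0 Kᶜ :=
  fun w hw => Set.indicator_apply_eq_zero.2 fun hD => h0 w hD hw

variable {E F : Type*} [NormedAddCommGroup E] [NormedSpace ℝ E] [NormedAddCommGroup F]
  [NormedSpace ℝ F] {D K : Set E} {g : E → F}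

theorem contDiff_indicator {n : WithTop ℕ∞} (hD : IsOpen D) (hK : IsClosed K) (hKD : K ⊆ D)
    (hg : ContDiffOn ℝ n g D) (h0 : ∀ w ∈ D, w ∉ K → g w = 0) :
    ContDiff ℝ n (D.indicator g) := by
  refine contDiff_of_contDiffOn_union_of_isOpen (t := Kᶜ) (hg.congr (Set.eqOn_indicator))
    (contDiffOn_const.congr (indicator_eqOn_compl h0)) ?_ hD hK.isOpen_compl
  exact Set.eq_univ_of_forall fun w => (em (w ∈ K)).imp (fun hw => hKD hw) id

theorem fderiv_indicator_apply (hD : IsOpen D) (hK : IsClosed K) (hKD : K ⊆ D)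
    (h0 : ∀ w ∈ D, w ∉ K → g w = 0) (v : E) :
    (fun w => fderiv ℝ (D.indicator g) w v) = D.indicator fun w => fderiv ℝ g w v := by
  ext w
  by_cases hw : w ∈ D
  · rw [Set.indicator_of_mem hw,
      (Set.eqOn_indicator.eventuallyEq_of_mem (hD.mem_nhds hw)).fderiv_eq]
  · rw [Set.indicator_of_notMem hw, ((indicator_eqOn_compl h0).eventuallyEq_of_mem
      (hK.isOpen_compl.mem_nhds fun hwK => hw (hKD hwK))).fderiv_eq]
    simp

variable [MeasurableSpace E] [BorelSpace E] {μ : Measure E}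

theorem integrableOn_fderiv [IsFiniteMeasureOnCompacts μ] (hD : IsOpen D) (hK : IsCompact K)
    (hK' : IsClosed K) (hKD : K ⊆ D) (hg : ContDiffOn ℝ 1 g D) (h0 : ∀ w ∈ D, w ∉ K → g w = 0)
    (v : E) : IntegrableOn (fun w => fderiv ℝ g w v) D μ := by
  rw [← integrable_indicator_iff hD.measurableSet, ← fderiv_indicator_apply hD hK' hKD h0]
  have hsupp : HasCompactSupport (D.indicator g) :=
    HasCompactSupport.intro' hK hK' (indicator_eqOn_compl h0)
  exact (((contDiff_indicator hD hK' hKD hg h0).continuous_fderiv (by simp)).clm_apply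
    continuous_const).integrable_of_hasCompactSupport (hsupp.fderiv_apply ℝ v)

theorem setIntegral_fderiv_eq_zero [FiniteDimensional ℝ E] [μ.IsAddHaarMeasure]
    {g : E → ℝ} (hD : IsOpen D) (hK : IsCompact K)
    (hKD : K ⊆ D) (hg : ContDiffOn ℝ 1 g D) (h0 : ∀ w ∈ D, w ∉ K → g w = 0) (v : E) :
    ∫ w in D, fderiv ℝ g w v ∂μ = 0 := by
  have hcd := contDiff_indicator hD hK.isClosed hKD hg h0
  have hsupp : HasCompactSupport (D.indicator g) :=
    HasCompactSupport.intro hK (indicator_eqOn_compl h0)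
  have hint : Integrable (fun w => fderiv ℝ (D.indicator g) w v) μ :=
    ((hcd.continuous_fderiv (by simp)).clm_apply
      continuous_const).integrable_of_hasCompactSupport (hsupp.fderiv_apply ℝ v)
  have hparts := integral_mul_fderiv_eq_neg_fderiv_mul_of_integrable (μ := μ) (𝕜 := ℝ)
    (f := fun _ => (1 : ℝ)) (v := v) (by simp) (by simpa using hint)
    (by simpa using hcd.continuous.integrable_of_hasCompactSupport hsupp) (by simp)
    fun w _ => hcd.differentiable (by simp) w
  rw [← integral_indicator hD.measurableSet, ← fderiv_indicator_apply hD hK.isClosed hKD h0]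
  simpa using hparts

end Indicator

section Local

variable {F : ℂ → SLTilde} {D K : Set ℂ} {w : ℂ} {r : ℂ → ℝ}

theorem tangentialDeriv_const (F : ℂ → SLTilde) (a : ℝ) (w : ℂ) :
    tangentialDeriv F (fun _ => a) w = 0 := by
  simp [tangentialDeriv]

theorem tangentialDeriv_sum (F : ℂ → SLTilde) {ι : Type*} (t : Finset ι) {r : ι → ℂ → ℝ}
    (hr : ∀ i ∈ t, DifferentiableAt ℝ (r i) w) :
    tangentialDeriv F (fun p => ∑ i ∈ t, r i p) w = ∑ i ∈ t, tangentialDeriv F (r i) w := by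
  simp only [tangentialDeriv, fderiv_fun_sum hr, sum_apply, Finset.sum_mul,
    ← Finset.sum_add_distrib, Finset.sum_div]

namespace ConformalOn

theorem continuousOn_tangentialDeriv (h : ConformalOn F D) (hr : ContDiffOn ℝ 1 r D) :
    ContinuousOn (tangentialDeriv F r) D := by
  have hfderiv (v : ℂ) : ContinuousOn (fun w => fderiv ℝ r w v) D :=
    (hr.continuousOn_fderiv_of_isOpen h.isOpen (by simp)).clm_apply continuousOn_const
  have hleft (v : ℂ) : ContinuousOn (fun w => leftDeriv F w v 2) D :=
    (h.smoothOn.contDiffOn_leftDeriv h.isOpen v 2).continuousOn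
  exact (((hfderiv 1).mul (hleft 1)).add ((hfderiv Complex.I).mul (hleft Complex.I))).div
    (h.smoothOn.continuousOn_firstForm h.isOpen 1 1) fun w hw => (h.conformal w hw).1.ne'

/- The connection terms of `tension_eq` vanish in the component of `e₃`: this is where `e₃` being a
Killing field enters. -/
theorem secondLeftDeriv_add_secondLeftDeriv (h : ConformalOn F D) (hw : w ∈ D) :
    (secondLeftDeriv F w 1 1 + secondLeftDeriv F w Complex.I Complex.I) 2 =
      2 * (firstForm F w 1 1 * (meanCurvatureAt F w * unitNormal F w 2)) := by
  have hpos := (h.conformal w hw).1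
  have htension : secondLeftDeriv F w 1 1 2 + nabla (leftDeriv F w 1) (leftDeriv F w 1) 2 +
      (secondLeftDeriv F w Complex.I Complex.I 2 +
        nabla (leftDeriv F w Complex.I) (leftDeriv F w Complex.I) 2) =
      2 * meanCurvatureAt F w * areaVector F w 2 := congrFun (h.tension_eq hw) 2
  simp only [nabla_apply, Matrix.cons_val] at htension
  rw [unitNormal_eq, h.sqrt_gramDet hw, Pi.add_apply, Pi.smul_apply, smul_eq_mul]
  field_simp
  linear_combination htension

theorem firstForm_mul_tangentialDeriv_add (h : ConformalOn F D) (hw : w ∈ D)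
    (hr : DifferentiableAt ℝ r w) :
    firstForm F w 1 1 *
        (tangentialDeriv F r w + 2 * (r w * (meanCurvatureAt F w * unitNormal F w 2))) =
      fderiv ℝ (fun p => r p * leftDeriv F p 1 2) w 1 +
        fderiv ℝ (fun p => r p * leftDeriv F p Complex.I 2) w Complex.I := by
  have hmul (v : ℂ) : fderiv ℝ (fun p => r p * leftDeriv F p v 2) w v =
      r w * secondLeftDeriv F w v v 2 + leftDeriv F w v 2 * fderiv ℝ r w v := by
    rw [fderiv_fun_mul hr (h.smoothOn.differentiableAt_leftDeriv h.isOpen hw v 2)]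
    rfl
  have hdiv := h.secondLeftDeriv_add_secondLeftDeriv hw
  rw [Pi.add_apply] at hdiv
  rw [hmul, hmul, tangentialDeriv, mul_add, mul_div_cancel₀ _ (h.conformal w hw).1.ne']
  linear_combination -r w * hdiv

theorem setIntegral_tangentialDeriv_add (h : ConformalOn F D) (hK : IsCompact K) (hKD : K ⊆ D)
    (hr : ContDiffOn ℝ ∞ r D) (h0 : ∀ w ∈ D, w ∉ K → r w = 0) :
    ∫ w in D, firstForm F w 1 1 *
      (tangentialDeriv F r w + 2 * (r w * (meanCurvatureAt F w * unitNormal F w 2))) = 0 := by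
  have hprod (v : ℂ) : ContDiffOn ℝ 1 (fun p => r p * leftDeriv F p v 2) D :=
    (hr.mul (h.smoothOn.contDiffOn_leftDeriv h.isOpen v 2)).of_le (by simp)
  have hzero (v : ℂ) : ∀ w ∈ D, w ∉ K → r w * leftDeriv F w v 2 = 0 :=
    fun w hw hwK => by rw [h0 w hw hwK, zero_mul]
  have hint (v : ℂ) := integrableOn_fderiv (μ := volume) h.isOpen hK hK.isClosed hKD
    (hprod v) (hzero v) v
  rw [setIntegral_congr_fun h.isOpen.measurableSet fun w hw =>
      h.firstForm_mul_tangentialDeriv_add hw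
        ((hr.contDiffAt (h.isOpen.mem_nhds hw)).differentiableAt (by simp)),
    integral_add (hint 1) (hint Complex.I),
    setIntegral_fderiv_eq_zero h.isOpen hK hKD (hprod 1) (hzero 1),
    setIntegral_fderiv_eq_zero h.isOpen hK hKD (hprod Complex.I) (hzero Complex.I), add_zero]

end ConformalOn

end Local

section Killing

variable {M : Type*} [TopologicalSpace M] [ChartedSpace ℂ M] {f : M → SLTilde}
  {e : OpenPartialHomeomorph M ℂ} {r : M → ℝ}

/-- The left translation of the unit normal vector of a surface. -/
noncomputable def gaussMap (f : M → SLTilde) : M → Fin 3 → ℝ :=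
  ofParam fun e => unitNormal (inParam f e)

/-- The derivative of the function `r` on a surface in the direction of the tangential part of the
left invariant field `e₃`. -/
noncomputable def killingDeriv (f : M → SLTilde) (r : M → ℝ) : M → ℝ :=
  ofParam fun e => tangentialDeriv (inParam f e) (r ∘ e.symm)

theorem support_killingDeriv_subset (f : M → SLTilde) (r : M → ℝ) :
    Function.support (killingDeriv f r) ⊆ tsupport r := by
  intro p hp
  by_contra hpr
  refine hp ?_
  have hzero : r ∘ (chartAt ℂ p).symm =ᶠ[nhds (chartAt ℂ p p)] fun _ => 0 := by
    filter_upwards [(chartAt ℂ p).tendsto_symm (mem_chart_source ℂ p)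
      ((isClosed_tsupport r).isOpen_compl.mem_nhds hpr)] with w hw
    exact image_eq_zero_of_notMem_tsupport (f := r) hw
  simp [killingDeriv, ofParam, tangentialDeriv, hzero.fderiv_eq]

theorem killingDeriv_const (f : M → SLTilde) (a : ℝ) : killingDeriv f (fun _ => a) = 0 := by
  ext p
  exact tangentialDeriv_const _ a _

variable [IsManifold 𝓘(ℂ) ω M]

theorem killingDeriv_sum (f : M → SLTilde) {ι : Type*} (t : Finset ι) {r : ι → M → ℝ}
    (hr : ∀ i ∈ t, ContMDiff 𝓘(ℝ, ℂ) 𝓘(ℝ) ∞ (r i)) (p : M) :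
    killingDeriv f (fun p => ∑ i ∈ t, r i p) p = ∑ i ∈ t, killingDeriv f (r i) p :=
  tangentialDeriv_sum _ t fun i hi =>
    ((contDiffOn_comp_symm (hr i hi) (chartAt_mem_localParams p)).contDiffAt
      ((chartAt ℂ p).open_target.mem_nhds (mem_chart_target ℂ p))).differentiableAt (by simp)

theorem continuous_meanCurvature (hf : IsConformalImmersion f) : Continuous (meanCurvature f) :=
  (isParamInvariant_meanCurvatureAt hf).continuous_ofParam fun _ he =>
    (conformalOn_inParam hf he).continuousOn_meanCurvatureAt

theorem continuous_tangentSectional (hf : IsConformalImmersion f) :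
    Continuous (tangentSectional f) :=
  (isParamInvariant_tangentSectionalAt hf).continuous_ofParam fun _ he =>
    (conformalOn_inParam hf he).continuousOn_tangentSectionalAt

theorem continuous_gaussMap (hf : IsConformalImmersion f) : Continuous (gaussMap f) :=
  (isParamInvariant_unitNormal hf).continuous_ofParam fun _ he =>
    (conformalOn_inParam hf he).continuousOn_unitNormal

theorem isParamInvariant_tangentialDeriv (hf : IsConformalImmersion f)
    (hr : ContMDiff 𝓘(ℝ, ℂ) 𝓘(ℝ) ∞ r) :
    IsParamInvariant (M := M) fun e => tangentialDeriv (inParam f e) (r ∘ e.symm) := by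
  intro e he e' he' w hw
  refine (paramChange_inParam hf he he').tangentialDeriv_eq hw ?_ fun p hp => ?_
  · exact ((contDiffOn_comp_symm hr he').contDiffAt
      (e'.open_target.mem_nhds (e'.map_source hw.2))).differentiableAt (by simp)
  · exact congrArg r (e'.left_inv hp.2).symm

theorem continuous_killingDeriv (hf : IsConformalImmersion f)
    (hr : ContMDiff 𝓘(ℝ, ℂ) 𝓘(ℝ) ∞ r) : Continuous (killingDeriv f r) :=
  (isParamInvariant_tangentialDeriv hf hr).continuous_ofParam fun _ he =>
    (conformalOn_inParam hf he).continuousOn_tangentialDeriv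
      ((contDiffOn_comp_symm hr he).of_le (by simp))

theorem continuous_killingDeriv_add (hf : IsConformalImmersion f)
    (hr : ContMDiff 𝓘(ℝ, ℂ) 𝓘(ℝ) ∞ r) : Continuous
      fun p => killingDeriv f r p + 2 * (r p * (meanCurvature f p * gaussMap f p 2)) := by
  have hX := continuous_killingDeriv hf hr
  have hH := continuous_meanCurvature hf
  have hN := continuous_gaussMap hf
  have hr' := hr.continuous
  fun_prop

variable [MeasurableSpace M] [BorelSpace M]

theorem integral_killingDeriv_add (hf : IsConformalImmersion f) (he : e ∈ localParams M)
    (hr : ContMDiff 𝓘(ℝ, ℂ) 𝓘(ℝ) ∞ r) (hrc : HasCompactSupport r) (hre : tsupport r ⊆ e.source) :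
    ∫ p, (killingDeriv f r p + 2 * (r p * (meanCurvature f p * gaussMap f p 2)))
      ∂(areaMeasure f) = 0 := by
  have hsupp : Function.support
      (fun p => killingDeriv f r p + 2 * (r p * (meanCurvature f p * gaussMap f p 2))) ⊆
        e.source := by
    intro p hp
    by_contra hpe
    have hpr : p ∉ tsupport r := fun h => hpe (hre h)
    have hX : killingDeriv f r p = 0 :=
      Function.notMem_support.1 fun h => hpr (support_killingDeriv_subset f r h)
    exact hp (by simp [hX, image_eq_zero_of_notMem_tsupport hpr])
  rw [integral_areaMeasure_of_support_subset hf he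
      (continuous_killingDeriv_add hf hr).aestronglyMeasurable hsupp,
    ← (conformalOn_inParam hf he).setIntegral_tangentialDeriv_add
      (hrc.isCompact.image_of_continuousOn (e.continuousOn.mono hre))
      (Set.image_subset_iff.2 fun p hp => e.map_source (hre hp)) (contDiffOn_comp_symm hr he)
      fun w hw hwK =>
        image_eq_zero_of_notMem_tsupport (f := r) fun h => hwK ⟨_, h, e.right_inv hw⟩]
  refine setIntegral_congr_fun e.open_target.measurableSet fun w hw => ?_
  have hX := (isParamInvariant_tangentialDeriv hf hr).ofParam_symm he hw
  have hH := (isParamInvariant_meanCurvatureAt hf).ofParam_symm he hw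
  have hN := congrFun ((isParamInvariant_unitNormal hf).ofParam_symm he hw) 2
  exact congrArg (firstForm (inParam f e) w 1 1 * ·)
    (congrArg₂ (fun x y => x + 2 * (r (e.symm w) * y)) hX (congrArg₂ (· * ·) hH hN))

end Killing

/-! ### The energy -/

section Energy

theorem exists_smoothPartitionOfUnity_fin {E H M : Type*} [NormedAddCommGroup E]
    [NormedSpace ℝ E] [FiniteDimensional ℝ E] [TopologicalSpace H] (I : ModelWithCorners ℝ E H)
    [TopologicalSpace M] [ChartedSpace H M] [IsManifold I ∞ M] [T2Space M] [CompactSpace M]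
    {U : M → Set M} (hU : ∀ p, IsOpen (U p)) (hmem : ∀ p, p ∈ U p) :
    ∃ (n : ℕ) (x : Fin n → M) (ρ : SmoothPartitionOfUnity (Fin n) I M Set.univ),
      ρ.IsSubordinate fun i => U (x i) := by
  obtain ⟨t, ht⟩ := isCompact_univ.elim_finite_subcover U hU
    fun p _ => Set.mem_iUnion.2 ⟨p, hmem p⟩
  refine ⟨t.card, fun i => t.equivFin.symm i, SmoothPartitionOfUnity.exists_isSubordinate I
    isClosed_univ _ (fun i => hU _) fun p hp => ?_⟩
  obtain ⟨q, hq, hpq⟩ := Set.mem_iUnion₂.1 (ht hp)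
  exact Set.mem_iUnion.2 ⟨t.equivFin ⟨q, hq⟩, by simpa using hpq⟩

variable {M : Type*} [TopologicalSpace M] [ChartedSpace ℂ M] {f : M → SLTilde}

/-- The density with respect to the area of the energy of a surface. -/
noncomputable def energyDensity (f : M → SLTilde) : M → ℂ :=
  ofParam fun e => energyDensityAt (inParam f e)

theorem isGeneratingSpinor_mono {F : ℂ → SLTilde} {D D' : Set ℂ} {ψ₁ ψ₂ : ℂ → ℂ}
    (hψ : IsGeneratingSpinor F D ψ₁ ψ₂) (hsub : D' ⊆ D) : IsGeneratingSpinor F D' ψ₁ ψ₂ :=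
  ⟨hψ.1.mono hsub, hψ.2.1.mono hsub, fun w hw => hψ.2.2 w (hsub hw)⟩

variable [IsManifold 𝓘(ℂ) ω M]

theorem isParamInvariant_energyDensityAt (hf : IsConformalImmersion f) :
    IsParamInvariant (M := M) fun e => energyDensityAt (inParam f e) := by
  intro e he e' he' w hw
  have hH := isParamInvariant_meanCurvatureAt hf e he e' he' hw
  have hK := isParamInvariant_tangentSectionalAt hf e he e' he' hw
  have hN := isParamInvariant_unitNormal hf e he e' he' hw
  simp only [Function.comp_apply] at hH hK hN ⊢
  rw [energyDensityAt, energyDensityAt, hH, hK, hN]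

theorem continuous_energyDensity (hf : IsConformalImmersion f) : Continuous (energyDensity f) :=
  (isParamInvariant_energyDensityAt hf).continuous_ofParam fun _ he =>
    (conformalOn_inParam hf he).continuousOn_energyDensityAt

theorem exists_localParam_isGeneratingSpinor (hf : IsConformalImmersion f) (p : M) :
    ∃ e ∈ localParams M, p ∈ e.source ∧ ∃ ψ₁ ψ₂ : ℂ → ℂ,
      IsGeneratingSpinor (inParam f e) e.target ψ₁ ψ₂ := by
  set e := chartAt ℂ p
  have he : e ∈ localParams M := chartAt_mem_localParams p
  have hp : p ∈ e.source := mem_chart_source ℂ p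
  obtain ⟨D, -, hopen, hpD, ψ₁, ψ₂, hψ⟩ :=
    (conformalOn_inParam hf he).exists_isGeneratingSpinor (e.map_source hp)
  have hpre : IsOpen (e.source ∩ e ⁻¹' D) := e.isOpen_inter_preimage hopen
  refine ⟨e.restr (e.source ∩ e ⁻¹' D), restr_mem_maximalAtlas _ he hpre, ?_, ψ₁, ψ₂,
    isGeneratingSpinor_mono hψ fun w hw => ?_⟩
  · rw [e.restr_source' _ hpre]
    exact ⟨hp, hp, hpD⟩
  · have hsource := (e.restr (e.source ∩ e ⁻¹' D)).map_target hw
    rw [e.restr_source' _ hpre] at hsource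
    simpa [e.right_inv hw.1] using hsource.2.2

variable [CompactSpace M]

theorem exists_isEnergy [T2Space M] (hf : IsConformalImmersion f) : ∃ E, IsEnergy f E := by
  have := isManifold_real (M := M)
  choose e he hp ψ₁ ψ₂ hψ using exists_localParam_isGeneratingSpinor hf
  obtain ⟨n, x, ρ, hρ⟩ := exists_smoothPartitionOfUnity_fin 𝓘(ℝ, ℂ)
    (fun p => (e p).open_source) hp
  exact ⟨_, n, fun i => e (x i), fun i => ψ₁ (x i), fun i => ψ₂ (x i), _, _,
    ρ.toPartitionOfUnity, fun i => ⟨he _, hψ _, (conformalOn_inParam hf (he _)).isDiracPotential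
      (hψ _)⟩, hρ.toPartitionOfUnity, rfl⟩

variable [MeasurableSpace M] [BorelSpace M]

theorem eq_integral_energyDensity_of_isEnergy (hf : IsConformalImmersion f) {E : ℂ}
    (hE : IsEnergy f E) : E = ∫ p, energyDensity f p ∂(areaMeasure f) := by
  obtain ⟨n, e, ψ₁, ψ₂, U, V, ρ, he, hρ, rfl⟩ := hE
  rw [integral_areaMeasure_eq_sum hf (fun i => (he i).1) ρ hρ (continuous_energyDensity hf)]
  refine Finset.sum_congr rfl fun i _ => ?_
  obtain ⟨hei, hψ, hUV⟩ := he i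
  refine setIntegral_congr_fun (e i).open_target.measurableSet fun w hw => ?_
  have hdensity : energyDensity f ((e i).symm w) = energyDensityAt (inParam f (e i)) w :=
    (isParamInvariant_energyDensityAt hf).ofParam_symm hei hw
  simp only [hdensity, (conformalOn_inParam hf hei).diracPotential_mul hψ hUV hw,
    Complex.real_smul]
  ring

theorem integrable_meanCurvature_mul_gaussMap (hf : IsConformalImmersion f) :
    Integrable (fun p => meanCurvature f p * gaussMap f p 2) (areaMeasure f) :=
  integrable_areaMeasure_of_hasCompactSupport hf ((continuous_meanCurvature hf).mul
    ((continuous_apply 2).comp (continuous_gaussMap hf))) (HasCompactSupport.of_compactSpace _)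

theorem integrable_meanCurvature_sq_add (hf : IsConformalImmersion f) :
    Integrable (fun p => meanCurvature f p ^ 2 + 5 / 16 * tangentSectional f p - 1 / 4)
      (areaMeasure f) :=
  integrable_areaMeasure_of_hasCompactSupport hf ((((continuous_meanCurvature hf).pow 2).add
    ((continuous_tangentSectional hf).const_mul _)).sub continuous_const)
    (HasCompactSupport.of_compactSpace _)

variable [T2Space M]

theorem isEnergy_iff (hf : IsConformalImmersion f) {E : ℂ} :
    IsEnergy f E ↔ E = ∫ p, energyDensity f p ∂(areaMeasure f) := by
  refine ⟨eq_integral_energyDensity_of_isEnergy hf, ?_⟩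
  rintro rfl
  obtain ⟨E, hE⟩ := exists_isEnergy hf
  rwa [← eq_integral_energyDensity_of_isEnergy hf hE]

theorem integral_meanCurvature_mul_gaussMap (hf : IsConformalImmersion f) :
    ∫ p, meanCurvature f p * gaussMap f p 2 ∂(areaMeasure f) = 0 := by
  have := isManifold_real (M := M)
  obtain ⟨n, x, ρ, hρ⟩ := exists_smoothPartitionOfUnity_fin 𝓘(ℝ, ℂ)
    (fun p => (chartAt ℂ p).open_source) (mem_chart_source ℂ (M := M))
  have hone (p : M) : ∑ i, ρ i p = 1 := by
    rw [← finsum_eq_sum_of_fintype, ρ.sum_eq_one (Set.mem_univ p)]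
  have hkilling (p : M) : ∑ i, killingDeriv f (ρ i) p = 0 := by
    rw [← killingDeriv_sum f _ (fun i _ => (ρ i).contMDiff), funext hone, killingDeriv_const,
      Pi.zero_apply]
  set q : M → ℝ := fun p => meanCurvature f p * gaussMap f p 2
  have hint (i) : Integrable (fun p => killingDeriv f (ρ i) p + 2 * (ρ i p * q p))
      (areaMeasure f) :=
    integrable_areaMeasure_of_hasCompactSupport hf
      (continuous_killingDeriv_add hf (ρ i).contMDiff) (HasCompactSupport.of_compactSpace _)
  have hsum : ∫ p, 2 * q p ∂(areaMeasure f) = 0 := by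
    calc ∫ p, 2 * q p ∂(areaMeasure f)
        = ∫ p, ∑ i, (killingDeriv f (ρ i) p + 2 * (ρ i p * q p)) ∂(areaMeasure f) := by
          simp only [Finset.sum_add_distrib, hkilling, ← Finset.mul_sum, ← Finset.sum_mul, hone,
            zero_add, one_mul]
      _ = 0 := by
          rw [integral_finsetSum _ fun i _ => hint i]
          exact Finset.sum_eq_zero fun i _ => integral_killingDeriv_add hf
            (chartAt_mem_localParams (x i)) (ρ i).contMDiff (HasCompactSupport.of_compactSpace _)
            (hρ i)
  simpa [integral_const_mul] using hsum

theorem integral_energyDensity (hf : IsConformalImmersion f) :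
    ∫ p, energyDensity f p ∂(areaMeasure f) =
      ((1 / 4 * ∫ p, (meanCurvature f p ^ 2 + 5 / 16 * tangentSectional f p - 1 / 4)
        ∂(areaMeasure f) : ℝ) : ℂ) := by
  have hre := ((integrable_meanCurvature_sq_add hf).const_mul (1 / 4)).ofReal (𝕜 := ℂ)
  have him := (((integrable_meanCurvature_mul_gaussMap hf).const_mul (5 / 8)).ofReal
    (𝕜 := ℂ)).const_mul Complex.I
  refine (integral_sub hre him).trans ?_
  simp only [integral_const_mul, RCLike.ofReal_eq_complex_ofReal, integral_complex_ofReal,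
    integral_meanCurvature_mul_gaussMap hf, mul_zero, Complex.ofReal_zero, sub_zero]

end Energy

end SLTilde

theorem mainTheorem10 {M : Type*} [TopologicalSpace M] [T2Space M] [CompactSpace M]
    [ChartedSpace ℂ M] [IsManifold 𝓘(ℂ) ω M] [MeasurableSpace M] [BorelSpace M]
    (f : M → SLTilde) (hf : IsConformalImmersion f) :
    MeasureTheory.Integrable
      (fun p => meanCurvature f p ^ 2 + 5 / 16 * tangentSectional f p - 1 / 4) (areaMeasure f) ∧
    ∀ E : ℂ, IsEnergy f E ↔
      E = ((1 / 4 * ∫ p, (meanCurvature f p ^ 2 + 5 / 16 * tangentSectional f p - 1 / 4)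
        ∂(areaMeasure f) : ℝ) : ℂ) :=
  ⟨integrable_meanCurvature_sq_add hf, fun E => by
    rw [isEnergy_iff hf, integral_energyDensity hf]⟩
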